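/- Let $S^2\subset\mathbb R^3$ be the unit sphere with surface measure $\sigma$ ($\sigma(S^2)=4\pi$), let $(Y_{\ell,m})_{\ell\ge 0,\,-\ell\le m\le \ell}$ be the standard orthonormal complex spherical harmonics, and for a rotation $\rho\in SO(3)$ let $D^\ell(\rho)$ be the $(2\ell+1)\times(2\ell+1)$ Wigner matrix, with entries $D^\ell(\rho)_{m',m}=\int_{S^2}Y_{\ell,m}(\rho^{-1}x)\overline{Y_{\ell,m'}(x)}\,d\sigma(x)$, so that $\sum_{m'}D^\ell(\rho)_{m',m}Y_{\ell,m'}(x)=Y_{\ell,m}(\rho^{-1}x)$. Let $(\Omega,\mathcal F,P)$ be a probability space and let $T:\Omega\times S^2\to\mathbb R$ be jointly measurable with $T\in L^2(P\otimes\sigma)$. Put $a_{\ell,m}=\int_{S^2}T(x)\overline{Y_{\ell,m}(x)}\,d\sigma(x)$ and $a_{\ell\cdot}=(a_{\ell,-\ell},\dots,a_{\ell,\ell})^T$. A field $F:\Omega\times S^2\to\mathbb R$ is called strongly isotropic if for all $k$, all $x_1,\dots,x_k\in S^2$ and all rotations $\rho$, the vectors $(F(x_1),\dots,F(x_k))$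 and $(F(\rho x_1),\dots,F(\rho x_k))$ have the same law. Suppose that for every rotation $\rho$, every $k\ge1$ and all $\ell_1,\dots,\ell_k\ge0$, $$(D^{\ell_1}(\rho)a_{\ell_1\cdot},\dots,D^{\ell_k}(\rho)a_{\ell_k\cdot})\overset{d}{=}(a_{\ell_1\cdot},\dots,a_{\ell_k\cdot}).$$ Then $T$, as an element of $L^2(\Omega\times S^2)$, is strongly isotropic. Precisely: 1. There is a jointly measurable $T':\Omega\times S^2\to\mathbb R$ with $T'=T$ $(P\otimes\sigma)$-almost everywhere which is strongly isotropic and is given at every point by the spherical harmonic expansion of $T$: for every $x\in S^2$, $\sum_{\ell\le L}\sum_{m=-\ell}^{\ell}a_{\ell,m}Y_{\ell,m}(x)\to T'(x)$ in $L^2(\Omega)$ as $L\to\infty$. 2. If for every $x\in S^2$ the partial sums $\sum_{\ell\le L}\sum_{m}a_{\ell,m}Y_{\ell,m}(x)$ converge to $T(x)$ in probability, then $T$ itself is strongly isotropic. 3. If $T$ is continuous in probability (for every $x\in S^2$, $T(y)\to T(x)$ in probability as $y\to x$), then $T$ itself is strongly isotropic. -/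

import Mathlib

open MeasureTheory ProbabilityTheory Filter Topology

/-- Euclidean three-space. -/
abbrev E3 : Type := EuclideanSpace ℝ (Fin 3)

/-- The unit sphere in Euclidean three-space. -/
abbrev S2 : Type := Metric.sphere (0 : E3) 1

/-- The surface measure on the unit sphere, of total mass `4π`. -/
noncomputable def surfaceMeasure : Measure S2 := (volume : Measure E3).toSphere

/-- The rotation group `SO(3)`: linear isometries of Euclidean three-space of determinant one. -/
def Rot3 : Subgroup (E3 ≃ₗᵢ[ℝ] E3) where
  carrier := {ρ | LinearMap.det (ρ.toLinearEquiv : E3 →ₗ[ℝ] E3) = 1}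
  one_mem' := by
    have h : ((1 : E3 ≃ₗᵢ[ℝ] E3).toLinearEquiv : E3 →ₗ[ℝ] E3) = LinearMap.id := rfl
    simp only [Set.mem_ofPred_eq, h, LinearMap.det_id]
  mul_mem' := by
    intro a b ha hb
    have h : ((a * b).toLinearEquiv : E3 →ₗ[ℝ] E3) =
        (a.toLinearEquiv : E3 →ₗ[ℝ] E3) ∘ₗ (b.toLinearEquiv : E3 →ₗ[ℝ] E3) := rfl
    simp only [Set.mem_ofPred_eq] at ha hb ⊢
    rw [h, LinearMap.det_comp, ha, hb, one_mul]
  inv_mem' := by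
    intro a ha
    have h : (a.toLinearEquiv : E3 →ₗ[ℝ] E3) ∘ₗ ((a⁻¹).toLinearEquiv : E3 →ₗ[ℝ] E3) =
        LinearMap.id := by
      ext1 x
      exact a.apply_symm_apply x
    have h2 := congrArg LinearMap.det h
    simp only [Set.mem_ofPred_eq] at ha ⊢
    rwa [LinearMap.det_comp, ha, one_mul, LinearMap.det_id] at h2

/-- The action of a rotation on a point of the sphere. -/
noncomputable def rotate (ρ : Rot3) (x : S2) : S2 :=
  ⟨(ρ : E3 ≃ₗᵢ[ℝ] E3) x, by simp⟩

/-- The Legendre polynomial `P_ℓ`, by Rodrigues' formula (so that `P_ℓ(1) = 1`). -/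
noncomputable def legendrePoly (ℓ : ℕ) : Polynomial ℝ :=
  Polynomial.C (1 / (2 ^ ℓ * (ℓ.factorial : ℝ))) *
    Polynomial.derivative^[ℓ] ((Polynomial.X ^ 2 - 1) ^ ℓ)

/-- The complex spherical harmonic `Y_{ℓ,m}`, for `-ℓ ≤ m ≤ ℓ`, with the Condon-Shortley phase.
In spherical coordinates `x = (sin θ cos φ, sin θ sin φ, cos θ)` and for `m ≥ 0` it is
`(-1)^m √((2ℓ+1)/(4π) · (ℓ-m)!/(ℓ+m)!) (sin θ)^m P_ℓ^{(m)}(cos θ) e^{imφ}`, written here with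
`(sin θ)^m e^{imφ} = (x₀ + i x₁)^m`, and `Y_{ℓ,-m} = (-1)^m conj Y_{ℓ,m}`. -/
noncomputable def sphHarm (ℓ : ℕ) (m : ℤ) (x : S2) : ℂ :=
  (Real.sqrt ((2 * (ℓ : ℝ) + 1) / (4 * Real.pi) *
      (((ℓ - m.natAbs).factorial : ℝ) / ((ℓ + m.natAbs).factorial : ℝ))) : ℂ) *
    (if 0 ≤ m then (-1) ^ m.natAbs * ((x.1 0 : ℂ) + Complex.I * (x.1 1 : ℂ)) ^ m.natAbs
      else ((x.1 0 : ℂ) - Complex.I * (x.1 1 : ℂ)) ^ m.natAbs) *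
    (((Polynomial.derivative^[m.natAbs] (legendrePoly ℓ)).eval (x.1 2) : ℝ) : ℂ)

/-- The orders `m = -ℓ, …, ℓ` belonging to the degree `ℓ`. -/
abbrev Order (ℓ : ℕ) : Type := ↥(Finset.Icc (-(ℓ : ℤ)) (ℓ : ℤ))

/-- The Wigner matrix `D^ℓ(ρ)`: the matrix, in the orthonormal system `Y_{ℓ,m}`, of the operator
`f ↦ f ∘ ρ⁻¹`, so that `∑_{m'} D^ℓ(ρ)_{m',m} Y_{ℓ,m'}(x) = Y_{ℓ,m}(ρ⁻¹ x)`. -/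
noncomputable def wignerD (ℓ : ℕ) (ρ : Rot3) : Matrix (Order ℓ) (Order ℓ) ℂ :=
  Matrix.of fun m' m =>
    ∫ x, sphHarm ℓ m (rotate ρ⁻¹ x) * (starRingEnd ℂ) (sphHarm ℓ m' x) ∂surfaceMeasure

section RandomField

variable {Ω : Type*}

/-- The block `a_{ℓ·} = (a_{ℓ,-ℓ}, …, a_{ℓ,ℓ})` of spherical harmonic coefficients
`a_{ℓ,m}(ω) = ∫ T(ω, x) conj(Y_{ℓ,m}(x)) dσ(x)` of a field. -/
noncomputable def coeffBlock (T : Ω → S2 → ℝ) (ℓ : ℕ) (ω : Ω) : Order ℓ → ℂ := fun m =>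
  ∫ x, (T ω x : ℂ) * (starRingEnd ℂ) (sphHarm ℓ m x) ∂surfaceMeasure

/-- The partial sum `∑_{ℓ ≤ L} ∑_m a_{ℓ,m}(ω) Y_{ℓ,m}(x)` of the expansion of a field. -/
noncomputable def partialSum (T : Ω → S2 → ℝ) (L : ℕ) (x : S2) (ω : Ω) : ℂ :=
  ∑ ℓ ∈ Finset.range (L + 1), ∑ m : Order ℓ, coeffBlock T ℓ ω m * sphHarm ℓ m x

/-- Strong isotropy: all finite-dimensional laws are invariant under rotation. -/
def StronglyIsotropic [MeasurableSpace Ω] (P : Measure Ω) (T : Ω → S2 → ℝ) : Prop :=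
  ∀ (k : ℕ) (x : Fin k → S2) (ρ : Rot3),
    IdentDistrib (fun ω i => T ω (x i)) (fun ω i => T ω (rotate ρ (x i))) P P

/-- The joint law of any finite list of coefficient blocks is invariant under the Wigner
matrices. -/
def CoeffInvariant [MeasurableSpace Ω] (P : Measure Ω) (T : Ω → S2 → ℝ) : Prop :=
  ∀ (ρ : Rot3) (k : ℕ), 1 ≤ k → ∀ ℓ : Fin k → ℕ,
    IdentDistrib
      (fun ω (i : Fin k) => (wignerD (ℓ i) ρ).mulVec (coeffBlock T (ℓ i) ω))
      (fun ω (i : Fin k) => coeffBlock T (ℓ i) ω) P P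

end RandomField

/-!
Write `T_L(x)` for the partial sum of the expansion of the field `T` at the point `x`.

The Wigner relation `Y_{ℓ,m}(ρ⁻¹ x) = ∑ D^ℓ(ρ)_{m',m} Y_{ℓ,m'}(x)` (`sphHarm_rotate`) turns the
hypothesis on the coefficients into the invariance in law of the family `(T_L(x))_{L,x}` under
rotations of the points (`CoeffInvariant.identDistrib_partialSum`). In particular
`E |T_L(x) - T_M(x)|²` does not depend on `x`, since rotations act transitively on the sphere. By
Tonelli it therefore equals `1 / 4π` times the square of the norm of `T_L - T_M` in `L²(Ω × S²)`,
which is small because the harmonics are complete: the expansion is a Cauchy sequence in `L²(Ω)` at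
every point, uniformly on the sphere (`CoeffInvariant.eLpNorm_increment_lt`). No information on the
covariance of the coefficients, hence no Schur lemma, is needed. A subsequence with summable
increments converges almost surely at every point, and its pointwise upper limit is the jointly
measurable version (`CoeffInvariant.exists_uniform_limit`). Equality in law passes to limits in
probability (`identDistrib_of_tendstoInMeasure`), which gives isotropy of the version and of any
field which is the pointwise limit of its expansion. If `T` is continuous in probability, every
point is a limit of points at which `T` and the version agree almost surely, and the same principle
applies (`StronglyIsotropic.of_ae_eq`).

The facts about spherical harmonics are obtained as follows. Orthogonality in the order `m` comes
from the rotations about the third axis; for equal orders, Archimedes' theorem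
(`integral_polynomial_height`, proved by comparing Gaussian moments in polar and Cartesian
coordinates) reduces the inner products to integrals over `[-1, 1]`, which Rodrigues' formula and
repeated integration by parts evaluate. The harmonics of degree at most `L` span exactly the
restrictions to the sphere of the polynomials of degree at most `L` (`harmSpan_eq_affineFns_pow`).
This space is invariant under isometries, and so is the orthogonal complement in it of the
polynomials of lower degree: this is the Wigner relation. The union over `L` is a dense algebra by
the Stone-Weierstrass theorem, which makes the harmonics a Hilbert basis of `L²(S²)`.
-/

open scoped InnerProductSpace ENNReal Pointwise

/-! ### The surface measure: invariance and Archimedes' theorem -/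

instance : IsFiniteMeasure surfaceMeasure :=
  inferInstanceAs (IsFiniteMeasure (volume : Measure E3).toSphere)

instance : surfaceMeasure.IsOpenPosMeasure :=
  inferInstanceAs ((volume : Measure E3).toSphere.IsOpenPosMeasure)

/-- The map of the sphere to itself induced by a linear isometry. For a rotation `ρ`, `rotate ρ` is
`sphereMap ρ` by definition. -/
noncomputable def sphereMap (e : E3 ≃ₗᵢ[ℝ] E3) (x : S2) : S2 := ⟨e x, by simp⟩

@[simp] lemma coe_sphereMap (e : E3 ≃ₗᵢ[ℝ] E3) (x : S2) : (sphereMap e x : E3) = e x := rfl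

lemma continuous_sphereMap (e : E3 ≃ₗᵢ[ℝ] E3) : Continuous (sphereMap e) :=
  (e.continuous.comp continuous_subtype_val).subtype_mk _

lemma measurableEmbedding_sphereMap (e : E3 ≃ₗᵢ[ℝ] E3) : MeasurableEmbedding (sphereMap e) :=
  (continuous_sphereMap e).measurableEmbedding
    fun _ _ h => Subtype.ext (e.injective (congrArg Subtype.val h))

lemma measurePreserving_sphereMap (e : E3 ≃ₗᵢ[ℝ] E3) :
    MeasurePreserving (sphereMap e) surfaceMeasure surfaceMeasure := by
  refine ⟨(continuous_sphereMap e).measurable, ?_⟩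
  ext s hs
  have hm := (continuous_sphereMap e).measurable hs
  rw [Measure.map_apply (continuous_sphereMap e).measurable hs, surfaceMeasure,
    Measure.toSphere_apply' _ hm, Measure.toSphere_apply' _ hs]
  congr 1
  -- the cone over the preimage is the preimage of the cone
  have hcone : Set.Ioo (0 : ℝ) 1 • ((↑) '' (sphereMap e ⁻¹' s) : Set E3) =
      e ⁻¹' (Set.Ioo (0 : ℝ) 1 • ((↑) '' s)) := by
    ext y
    simp only [Set.mem_smul, Set.mem_image, Set.mem_preimage, exists_exists_and_eq_and]
    constructor
    · rintro ⟨r, hr, x, hx, rfl⟩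
      exact ⟨r, hr, _, hx, by simp⟩
    · rintro ⟨r, hr, x, hx, hxy⟩
      refine ⟨r, hr, sphereMap e.symm x, ?_, ?_⟩
      · have : sphereMap e (sphereMap e.symm x) = x := Subtype.ext (by simp)
        rwa [this]
      · apply e.injective
        simpa using hxy
  rw [hcone]
  exact e.measurePreserving.measure_preimage_equiv (f := e.toMeasurableEquiv) _

/-- Polar coordinates for the product of a homogeneous function of degree `n` and a radial one. -/
lemma integral_homogeneous_mul_radial (f : E3 → ℝ) (g : ℝ → ℝ) (n : ℕ)
    (hf : ∀ (r : ℝ) (x : E3), 0 < r → f (r • x) = r ^ n * f x) :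
    ∫ x : E3, f x * g ‖x‖ =
      (∫ x : S2, f x ∂surfaceMeasure) * ∫ r in Set.Ioi (0 : ℝ), r ^ (n + 2) * g r := by
  have hdim : Module.finrank ℝ E3 - 1 = 2 := by simp
  calc
    ∫ x : E3, f x * g ‖x‖ =
        ∫ x : ({(0)}ᶜ : Set E3), f x * g ‖x.1‖ ∂((volume : Measure E3).comap (↑)) := by
      rw [integral_subtype_comap (measurableSet_singleton _).compl fun x : E3 ↦ f x * g ‖x‖,
        restrict_compl_singleton]
    _ = ∫ x, f x.1 * (x.2.1 ^ n * g x.2) ∂surfaceMeasure.prod (.volumeIoiPow 2) := by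
      rw [← hdim, surfaceMeasure,
        ← (volume : Measure E3).measurePreserving_homeomorphUnitSphereProd.integral_comp
          (Homeomorph.measurableEmbedding _)]
      refine integral_congr_ae (Eventually.of_forall fun x => ?_)
      have hx : 0 < ‖x.1‖ := norm_pos_iff.2 x.2
      have h := hf ‖x.1‖ (‖x.1‖⁻¹ • x.1) hx
      rw [smul_inv_smul₀ hx.ne'] at h
      simp only [homeomorphUnitSphereProd_apply_snd_coe, homeomorphUnitSphereProd_apply_fst_coe]
      rw [h]; ring
    _ = (∫ x : S2, f x ∂surfaceMeasure) * ∫ r : Set.Ioi (0 : ℝ), r.1 ^ n * g r ∂.volumeIoiPow 2 :=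
      integral_prod_mul (fun x : S2 => f x) (fun r : Set.Ioi (0 : ℝ) => r.1 ^ n * g r)
    _ = _ := by
      congr 1
      simp only [Measure.volumeIoiPow, ENNReal.ofReal]
      rw [integral_withDensity_eq_integral_smul,
        integral_subtype_comap measurableSet_Ioi
          fun a : ℝ ↦ Real.toNNReal (a ^ 2) • (a ^ n * g a)]
      · refine setIntegral_congr_fun measurableSet_Ioi fun x hx ↦ ?_
        simp only [NNReal.smul_def, Real.coe_toNNReal _ (pow_nonneg (le_of_lt hx) _), smul_eq_mul]
        ring
      · exact (measurable_subtype_coe.pow_const _).real_toNNReal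

/-- The Gaussian moment `∫_0^∞ t^n exp(-t²) dt`. -/
noncomputable def gaussMoment (n : ℕ) : ℝ := ∫ t in Set.Ioi (0 : ℝ), t ^ n * Real.exp (-t ^ 2)

lemma gaussMoment_eq_Gamma (n : ℕ) : gaussMoment n = Real.Gamma (((n : ℝ) + 1) / 2) / 2 := by
  have h := integral_rpow_mul_exp_neg_rpow (p := 2) (q := n) (by norm_num)
    (by have : (0 : ℝ) ≤ n := n.cast_nonneg
        linarith)
  rw [gaussMoment]
  simp only [Real.rpow_natCast, Real.rpow_two] at h
  rw [h]; ring

lemma gaussMoment_pos (n : ℕ) : 0 < gaussMoment n := by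
  rw [gaussMoment_eq_Gamma]
  have := Real.Gamma_pos_of_pos (show (0 : ℝ) < ((n : ℝ) + 1) / 2 by positivity)
  positivity

lemma gaussMoment_add_two (n : ℕ) :
    gaussMoment (n + 2) = ((n : ℝ) + 1) / 2 * gaussMoment n := by
  have h : (((n + 2 : ℕ) : ℝ) + 1) / 2 = ((n : ℝ) + 1) / 2 + 1 := by push_cast; ring
  rw [gaussMoment_eq_Gamma, gaussMoment_eq_Gamma, h, Real.Gamma_add_one (by positivity)]
  ring

lemma integral_pow_mul_exp_neg_sq (n : ℕ) :
    ∫ t : ℝ, t ^ n * Real.exp (-t ^ 2) = if Even n then 2 * gaussMoment n else 0 := by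
  split_ifs with hn
  · have h := integral_comp_abs (f := fun t : ℝ => t ^ n * Real.exp (-t ^ 2))
    simpa [hn.pow_abs, gaussMoment] using h
  · have h := integral_neg_eq_self (fun t : ℝ => t ^ n * Real.exp (-t ^ 2)) volume
    simp only [(Nat.not_even_iff_odd.1 hn).neg_pow, even_two.neg_pow, neg_mul, integral_neg] at h
    linarith

/-- The Gaussian integral of a power of a coordinate, by Fubini in Cartesian coordinates. -/
lemma integral_gaussian_coord (n : ℕ) :
    ∫ x : E3, (x 2) ^ n * Real.exp (-‖x‖ ^ 2) =
      Real.pi * ∫ t : ℝ, t ^ n * Real.exp (-t ^ 2) := by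
  rw [← (EuclideanSpace.volume_preserving_symm_measurableEquiv_toLp (Fin 3)).symm.integral_comp
    (MeasurableEquiv.measurableEmbedding _)]
  have h := integral_fintype_prod_volume_eq_prod (𝕜 := ℝ) (E := fun _ : Fin 3 => ℝ)
    (fun (i : Fin 3) (t : ℝ) => if i = 2 then t ^ n * Real.exp (-t ^ 2) else Real.exp (-t ^ 2))
  have hg : ∫ t : ℝ, Real.exp (-t ^ 2) = Real.sqrt Real.pi := by
    simpa using integral_gaussian 1
  simp only [Fin.prod_univ_three] at h
  simp only [show (0 : Fin 3) ≠ 2 by decide, show (1 : Fin 3) ≠ 2 by decide, if_true, if_false,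
    hg, Real.mul_self_sqrt Real.pi_pos.le] at h
  rw [← h]
  refine integral_congr_ae (Eventually.of_forall fun x => ?_)
  simp only [EuclideanSpace.norm_sq_eq, Fin.sum_univ_three]
  simp [← Real.exp_add]
  rw [mul_left_comm, ← Real.exp_add]
  ring_nf

/-- The moments of the height: compare the Gaussian integral of `x₂ ^ n` in Cartesian and in polar
coordinates. -/
lemma integral_coord_pow (n : ℕ) :
    ∫ x : S2, (x.1 2) ^ n ∂surfaceMeasure = if Even n then 4 * Real.pi / (n + 1) else 0 := by
  have h := integral_homogeneous_mul_radial (fun x => (x 2) ^ n) (fun r => Real.exp (-r ^ 2)) n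
    (fun r x _ => by simp [mul_pow])
  rw [integral_gaussian_coord, integral_pow_mul_exp_neg_sq] at h
  change _ = _ * gaussMoment (n + 2) at h
  rw [gaussMoment_add_two] at h
  have h0 := gaussMoment_pos n
  have hn : (0 : ℝ) < (n : ℝ) + 1 := by positivity
  have key : ∀ a b : ℝ, a * (((n : ℝ) + 1) / 2 * gaussMoment n) =
      b * (((n : ℝ) + 1) / 2 * gaussMoment n) → a = b :=
    fun a b hab => mul_right_cancel₀ (by positivity) hab
  apply key
  rw [← h]
  split_ifs
  · field_simp; ring
  · simp

/-- Archimedes' theorem: the height is uniformly distributed on the sphere. -/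
lemma integral_polynomial_height (q : Polynomial ℝ) :
    ∫ x : S2, q.eval (x.1 2) ∂surfaceMeasure = 2 * Real.pi * ∫ t in (-1 : ℝ)..1, q.eval t := by
  have hint : ∀ q : Polynomial ℝ, Integrable (fun x : S2 => q.eval (x.1 2)) surfaceMeasure := by
    intro q
    refine Continuous.integrable_of_hasCompactSupport ?_ (HasCompactSupport.of_compactSpace _)
    exact q.continuous.comp (by fun_prop)
  induction q using Polynomial.induction_on' with
  | add p q hp hq =>
    simp only [Polynomial.eval_add]
    rw [integral_add (hint p) (hint q), hp, hq, intervalIntegral.integral_add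
      (p.continuous.intervalIntegrable _ _) (q.continuous.intervalIntegrable _ _)]
    ring
  | monomial n a =>
    simp only [Polynomial.eval_monomial]
    rw [integral_const_mul, integral_coord_pow, intervalIntegral.integral_const_mul, integral_pow]
    split_ifs with hn
    · have : Odd (n + 1) := hn.add_one
      rw [this.neg_one_pow]; ring
    · have : Even (n + 1) := (Nat.not_even_iff_odd.1 hn).add_one
      rw [this.neg_one_pow]; ring

/-! ### Legendre polynomials -/

section Legendre

open Polynomial

namespace Polynomial

lemma integral_mul_derivative_eq (p q : Polynomial ℝ) (a b : ℝ) :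
    ∫ t in a..b, (p * derivative q).eval t =
      (p * q).eval b - (p * q).eval a - ∫ t in a..b, (derivative p * q).eval t := by
  have h := intervalIntegral.integral_mul_deriv_eq_deriv_mul (a := a) (b := b)
    (fun x _ => p.hasDerivAt x) (fun x _ => q.hasDerivAt x)
    ((derivative p).continuous.intervalIntegrable _ _)
    ((derivative q).continuous.intervalIntegrable _ _)
  simpa only [eval_mul] using h

/-- Repeated integration by parts, when all boundary terms vanish. -/
lemma integral_mul_iterate_derivative_eq (n : ℕ) (p q : Polynomial ℝ) (a b : ℝ)
    (ha : ∀ i j, i + j + 1 = n → (derivative^[i] p * derivative^[j] q).eval a = 0)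
    (hb : ∀ i j, i + j + 1 = n → (derivative^[i] p * derivative^[j] q).eval b = 0) :
    ∫ t in a..b, (p * derivative^[n] q).eval t =
      (-1) ^ n * ∫ t in a..b, (derivative^[n] p * q).eval t := by
  induction n generalizing p with
  | zero => simp
  | succ n ih =>
    have hb0 := hb 0 n (by ring)
    have ha0 := ha 0 n (by ring)
    simp only [Function.iterate_zero, id_eq] at hb0 ha0
    rw [Function.iterate_succ_apply', integral_mul_derivative_eq, ha0, hb0,
      ih (derivative p) (fun i j hij => ha (i + 1) j (by omega))
        (fun i j hij => hb (i + 1) j (by omega)), Function.iterate_succ_apply]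
    ring

lemma iterate_derivative_eq_C_of_natDegree_le {p : Polynomial ℝ} {n : ℕ} (hp : p.natDegree ≤ n) :
    derivative^[n] p = C ((n.factorial : ℝ) * p.coeff n) := by
  have h0 : (derivative^[n] p).natDegree = 0 := by
    have := natDegree_iterate_derivative p n
    omega
  rw [eq_C_of_natDegree_eq_zero h0, coeff_iterate_derivative]
  simp [Nat.descFactorial_self]

end Polynomial

lemma natDegree_X_sq_sub_one_pow (l : ℕ) : ((X ^ 2 - 1 : ℝ[X]) ^ l).natDegree = 2 * l := by
  rw [natDegree_pow, ← C_1, natDegree_X_pow_sub_C, mul_comm]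

lemma coeff_X_sq_sub_one_pow (l : ℕ) : ((X ^ 2 - 1 : ℝ[X]) ^ l).coeff (2 * l) = 1 := by
  have h : ((X ^ 2 - 1 : ℝ[X]) ^ l).Monic := by
    rw [← C_1]; exact (monic_X_pow_sub_C (1 : ℝ) two_ne_zero).pow l
  rw [← natDegree_X_sq_sub_one_pow]; exact h

lemma natDegree_legendrePoly_le (l : ℕ) : (legendrePoly l).natDegree ≤ l := by
  refine (natDegree_C_mul_le _ _).trans ((natDegree_iterate_derivative _ _).trans ?_)
  rw [natDegree_X_sq_sub_one_pow]; omega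

lemma coeff_legendrePoly (l : ℕ) :
    (legendrePoly l).coeff l = ((2 * l).factorial : ℝ) / (2 ^ l * (l.factorial : ℝ) ^ 2) := by
  rw [legendrePoly, coeff_C_mul, coeff_iterate_derivative, ← two_mul, coeff_X_sq_sub_one_pow]
  have h : (l.factorial : ℝ) * ((2 * l).descFactorial l : ℝ) = (2 * l).factorial := by
    have := Nat.factorial_mul_descFactorial (show l ≤ 2 * l by omega)
    rw [show 2 * l - l = l by omega] at this
    exact_mod_cast this
  have h0 : (l.factorial : ℝ) ≠ 0 := by positivity
  rw [nsmul_eq_mul, ← h]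
  field_simp

lemma iterate_derivative_legendrePoly (l m : ℕ) : derivative^[m] (legendrePoly l) =
    C (1 / (2 ^ l * (l.factorial : ℝ))) * derivative^[l + m] ((X ^ 2 - 1) ^ l) := by
  rw [legendrePoly, iterate_derivative_C_mul, ← Function.iterate_add_apply, add_comm]

lemma natDegree_iterate_derivative_legendrePoly_le (l m : ℕ) :
    (derivative^[m] (legendrePoly l)).natDegree ≤ l - m :=
  (natDegree_iterate_derivative _ _).trans (Nat.sub_le_sub_right (natDegree_legendrePoly_le l) m)

lemma coeff_iterate_derivative_legendrePoly {l m : ℕ} (hm : m ≤ l) :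
    (derivative^[m] (legendrePoly l)).coeff (l - m) =
      (l.factorial : ℝ) / ((l - m).factorial : ℝ) *
        (((2 * l).factorial : ℝ) / (2 ^ l * (l.factorial : ℝ) ^ 2)) := by
  rw [coeff_iterate_derivative, Nat.sub_add_cancel hm, coeff_legendrePoly, nsmul_eq_mul]
  congr 1
  have := Nat.factorial_mul_descFactorial hm
  rw [eq_div_iff (by positivity), mul_comm]
  exact_mod_cast this

lemma integral_one_sub_sq_pow (l : ℕ) :
    (∫ t in (-1 : ℝ)..1, (1 - t ^ 2) ^ l) * ((2 * l + 1).factorial : ℝ) =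
      2 ^ (2 * l + 1) * (l.factorial : ℝ) ^ 2 := by
  induction l with
  | zero => norm_num
  | succ l ih =>
    have hc : ∀ k : ℕ, IntervalIntegrable (fun t : ℝ => (1 - t ^ 2) ^ k) volume (-1) 1 :=
      fun k => Continuous.intervalIntegrable (by fun_prop) _ _
    -- integrate the derivative of `t (1 - t²)^(l+1)`
    have h := intervalIntegral.integral_eq_sub_of_hasDerivAt (a := -1) (b := 1)
      (f := fun t : ℝ => t * (1 - t ^ 2) ^ (l + 1))
      (f' := fun t => (2 * l + 3) * (1 - t ^ 2) ^ (l + 1) - (2 * l + 2) * (1 - t ^ 2) ^ l)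
      (fun t _ => by
        have h1 : HasDerivAt (fun t : ℝ => 1 - t ^ 2) (-(2 * t)) t := by
          simpa using (hasDerivAt_pow 2 t).const_sub 1
        have h2 := (hasDerivAt_id t).mul (h1.pow (l + 1))
        refine h2.congr_deriv ?_
        push_cast [id_eq, Pi.pow_apply, Nat.add_sub_cancel]
        ring)
      (((hc (l + 1)).const_mul _).sub ((hc l).const_mul _))
    rw [intervalIntegral.integral_sub ((hc (l + 1)).const_mul _) ((hc l).const_mul _),
      intervalIntegral.integral_const_mul, intervalIntegral.integral_const_mul] at h
    have hz : (0 : ℝ) ^ (l + 1) = 0 := zero_pow l.succ_ne_zero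
    norm_num [hz] at h
    have h' : (2 * (l : ℝ) + 3) * (∫ t in (-1 : ℝ)..1, (1 - t ^ 2) ^ (l + 1)) =
      (2 * l + 2) * ∫ t in (-1 : ℝ)..1, (1 - t ^ 2) ^ l := by linarith
    have e1 : ((2 * (l + 1) + 1).factorial : ℝ) =
        (2 * l + 3) * ((2 * l + 2) * ((2 * l + 1).factorial : ℝ)) := by
      rw [show 2 * (l + 1) + 1 = (2 * l + 1) + 1 + 1 by ring, Nat.factorial_succ,
        Nat.factorial_succ]
      push_cast; ring
    have e2 : ((l + 1).factorial : ℝ) = (l + 1) * (l.factorial : ℝ) := by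
      rw [Nat.factorial_succ]; push_cast; ring
    rw [e1, e2]
    calc _ = ((2 * (l : ℝ) + 3) * (∫ t in (-1 : ℝ)..1, (1 - t ^ 2) ^ (l + 1))) *
          ((2 * l + 2) * ((2 * l + 1).factorial : ℝ)) := by ring
      _ = (2 * (l : ℝ) + 2) ^ 2 *
          ((∫ t in (-1 : ℝ)..1, (1 - t ^ 2) ^ l) * ((2 * l + 1).factorial : ℝ)) := by
        rw [h']; ring
      _ = _ := by rw [ih]; ring

/-- Rodrigues' formula moves all `l + m` derivatives to the first factor. The boundary terms vanish:
in each of them, either fewer than `m` derivatives fall on the first factor, which has an `m`-fold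
zero at `±1`, or fewer than `l` on the second, which has an `l`-fold zero. -/
lemma integral_weight_mul_legendrePoly (l m : ℕ) (h : ℝ[X]) :
    ∫ t in (-1 : ℝ)..1, ((1 - X ^ 2) ^ m * h * derivative^[m] (legendrePoly l)).eval t =
      (-1) ^ m / (2 ^ l * (l.factorial : ℝ)) *
        ∫ t in (-1 : ℝ)..1,
          (derivative^[l + m] ((1 - X ^ 2) ^ m * h)).eval t * (1 - t ^ 2) ^ l := by
  have hvan : ∀ s : ℝ, s ^ 2 = 1 → ∀ i j, i + j + 1 = l + m →
      (derivative^[i] ((1 - X ^ 2) ^ m * h) * derivative^[j] ((X ^ 2 - 1) ^ l)).eval s = 0 := by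
    intro s hs i j hij
    have root : ∀ (w p : ℝ[X]) (n i : ℕ), w.eval s = 0 → i < n → w ^ n ∣ p →
        (derivative^[i] p).eval s = 0 := by
      intro w p n i hw hi hp
      obtain ⟨r, hr⟩ := pow_sub_dvd_iterate_derivative_of_pow_dvd i hp
      rw [hr, eval_mul, eval_pow, hw, zero_pow (by omega), zero_mul]
    rw [eval_mul]
    rcases lt_or_ge j l with hj | hj
    · rw [root (X ^ 2 - 1) _ l j (by simp [hs]) hj dvd_rfl, mul_zero]
    · rw [root (1 - X ^ 2) _ m i (by simp [hs]) (by omega) (dvd_mul_right _ _), zero_mul]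
  rw [iterate_derivative_legendrePoly]
  have h1 := integral_mul_iterate_derivative_eq (l + m) ((1 - X ^ 2) ^ m * h) ((X ^ 2 - 1) ^ l)
    (-1) 1 (hvan _ (by norm_num)) (hvan _ (by norm_num))
  simp only [mul_left_comm _ (C _) _]
  simp only [eval_C_mul]
  rw [intervalIntegral.integral_const_mul, h1]
  have h2 : ∀ t : ℝ, ((X ^ 2 - 1 : ℝ[X]) ^ l).eval t = (-1) ^ l * (1 - t ^ 2) ^ l := by
    intro t
    rw [← mul_pow]; simp
  simp only [eval_mul (q := (X ^ 2 - 1 : ℝ[X]) ^ l), h2, mul_left_comm _ ((-1 : ℝ) ^ l) _]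
  rw [intervalIntegral.integral_const_mul, pow_add]
  have h3 : ((-1 : ℝ) ^ l) * (-1) ^ l = 1 := by rw [← mul_pow]; simp
  linear_combination ((-1) ^ m / (2 ^ l * (l.factorial : ℝ)) * ∫ t in (-1 : ℝ)..1,
          (derivative^[l + m] ((1 - X ^ 2) ^ m * h)).eval t * (1 - t ^ 2) ^ l) * h3

lemma integral_legendrePoly_of_lt {k l : ℕ} (m : ℕ) (hkl : k < l) (hm : m ≤ k) :
    ∫ t in (-1 : ℝ)..1, ((1 - X ^ 2) ^ m * derivative^[m] (legendrePoly k) *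
      derivative^[m] (legendrePoly l)).eval t = 0 := by
  rw [integral_weight_mul_legendrePoly, iterate_derivative_eq_zero]
  · simp
  · have h1 : ((1 - X ^ 2 : ℝ[X]) ^ m).natDegree ≤ m * 2 := by
      refine natDegree_pow_le_of_le _ ?_
      compute_degree
    have h2 := natDegree_mul_le_of_le h1 (natDegree_iterate_derivative_legendrePoly_le k m)
    omega

lemma integral_legendrePoly_self {l m : ℕ} (hm : m ≤ l) :
    ∫ t in (-1 : ℝ)..1, ((1 - X ^ 2) ^ m * derivative^[m] (legendrePoly l) *
      derivative^[m] (legendrePoly l)).eval t =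
      2 / (2 * (l : ℝ) + 1) * (((l + m).factorial : ℝ) / ((l - m).factorial : ℝ)) := by
  have h1 : ((1 - X ^ 2 : ℝ[X]) ^ m).natDegree ≤ m * 2 := by
    refine natDegree_pow_le_of_le _ ?_
    compute_degree
  have h2 := natDegree_mul_le_of_le h1 (natDegree_iterate_derivative_legendrePoly_le l m)
  have hw : ((1 - X ^ 2 : ℝ[X]) ^ m).coeff (m * 2) = (-1) ^ m := by
    have := coeff_pow_of_natDegree_le (p := (1 - X ^ 2 : ℝ[X])) (n := 2) (m := m)
      (by compute_degree)
    rw [this]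
    simp [coeff_one]
  have h3 := coeff_mul_add_eq_of_natDegree_le h1 (natDegree_iterate_derivative_legendrePoly_le l m)
  rw [integral_weight_mul_legendrePoly, iterate_derivative_eq_C_of_natDegree_le (by omega),
    show l + m = m * 2 + (l - m) by omega, h3, hw, coeff_iterate_derivative_legendrePoly hm]
  simp only [eval_C]
  rw [intervalIntegral.integral_const_mul]
  have hK := integral_one_sub_sq_pow l
  have e1 : ((2 * l + 1).factorial : ℝ) = (2 * l + 1) * ((2 * l).factorial : ℝ) := by
    rw [Nat.factorial_succ]; push_cast; ring
  rw [← eq_div_iff (by positivity), e1] at hK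
  rw [hK]
  have h4 : ((-1 : ℝ) ^ m) * (-1) ^ m = 1 := by rw [← mul_pow]; simp
  field_simp
  linear_combination (2 * 2 ^ (2 * l) : ℝ) * h4

end Legendre

/-! ### Orthonormality of the spherical harmonics -/

/-- The factor `(sin θ)^|m| e^{imφ}` of a spherical harmonic: a power of `x₀ + i x₁` for `m ≥ 0`,
of its conjugate for `m < 0`. -/
noncomputable def azimuth (m : ℤ) (x : S2) : ℂ :=
  if 0 ≤ m then ((x.1 0 : ℂ) + Complex.I * (x.1 1 : ℂ)) ^ m.natAbs
  else ((x.1 0 : ℂ) - Complex.I * (x.1 1 : ℂ)) ^ m.natAbs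

/-- The normalizing constant of `Y_{ℓ,m}`. -/
noncomputable def sphHarmNorm (ℓ m : ℕ) : ℝ :=
  Real.sqrt ((2 * (ℓ : ℝ) + 1) / (4 * Real.pi) *
      (((ℓ - m).factorial : ℝ) / ((ℓ + m).factorial : ℝ)))

lemma sphHarmNorm_sq (ℓ m : ℕ) : sphHarmNorm ℓ m * sphHarmNorm ℓ m =
    (2 * (ℓ : ℝ) + 1) / (4 * Real.pi) * (((ℓ - m).factorial : ℝ) / ((ℓ + m).factorial : ℝ)) :=
  Real.mul_self_sqrt (by positivity)

lemma sphHarmNorm_pos (ℓ m : ℕ) : 0 < sphHarmNorm ℓ m := Real.sqrt_pos.2 (by positivity)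

/-- The Condon-Shortley sign. -/
noncomputable def condonShortley (m : ℤ) : ℂ := if 0 ≤ m then (-1) ^ m.natAbs else 1

lemma condonShortley_mul_self (m : ℤ) : condonShortley m * condonShortley m = 1 := by
  unfold condonShortley
  split_ifs
  · rw [← mul_pow]; simp
  · simp

lemma star_condonShortley (m : ℤ) : (starRingEnd ℂ) (condonShortley m) = condonShortley m := by
  unfold condonShortley
  split_ifs <;> simp

lemma sphHarm_eq (ℓ : ℕ) (m : ℤ) (x : S2) : sphHarm ℓ m x =
    (sphHarmNorm ℓ m.natAbs * condonShortley m) * (azimuth m x *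
      (((Polynomial.derivative^[m.natAbs] (legendrePoly ℓ)).eval (x.1 2) : ℝ) : ℂ)) := by
  unfold sphHarm sphHarmNorm condonShortley azimuth
  split_ifs <;> ring

lemma continuous_azimuth (m : ℤ) : Continuous (azimuth m) := by
  unfold azimuth
  split_ifs <;> fun_prop

lemma continuous_sphHarm (ℓ : ℕ) (m : ℤ) : Continuous (sphHarm ℓ m) := by
  simp only [funext (sphHarm_eq ℓ m)]
  have := continuous_azimuth m
  have h : Continuous fun x : S2 =>
      (Polynomial.derivative^[m.natAbs] (legendrePoly ℓ)).eval (x.1 2) :=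
    (Polynomial.continuous _).comp (by fun_prop)
  fun_prop

lemma sum_sq_coord (x : S2) : x.1 0 ^ 2 + x.1 1 ^ 2 + x.1 2 ^ 2 = 1 := by
  have h : ‖x.1‖ ^ 2 = 1 := by simp
  rwa [EuclideanSpace.real_norm_sq_eq, Fin.sum_univ_three] at h

lemma azimuth_mul_star (m : ℤ) (x : S2) :
    azimuth m x * (starRingEnd ℂ) (azimuth m x) = (((1 - x.1 2 ^ 2) ^ m.natAbs : ℝ) : ℂ) := by
  have h : (1 : ℝ) - x.1 2 ^ 2 = x.1 0 ^ 2 + x.1 1 ^ 2 := by linarith [sum_sq_coord x]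
  unfold azimuth
  split_ifs
  all_goals
    simp only [map_pow, map_add, map_sub, map_mul, Complex.conj_I, Complex.conj_ofReal]
    rw [← mul_pow, h]
    push_cast
    congr 1
    linear_combination (-(x.1 1 : ℂ) ^ 2) * Complex.I_sq

/-- The rotation by the angle `α` about the third axis. -/
noncomputable def axialRotation (α : ℝ) : E3 ≃ₗᵢ[ℝ] E3 :=
  LinearIsometry.toLinearIsometryEquiv
    { toFun := fun x => !₂[Real.cos α * x 0 - Real.sin α * x 1,
        Real.sin α * x 0 + Real.cos α * x 1, x 2]
      map_add' := by
        intro x y; ext i; fin_cases i <;> simp <;> ring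
      map_smul' := by
        intro c x; ext i; fin_cases i <;> simp <;> ring
      norm_map' := by
        intro x
        simp only [LinearMap.coe_mk, AddHom.coe_mk]
        rw [← sq_eq_sq₀ (norm_nonneg _) (norm_nonneg _), EuclideanSpace.real_norm_sq_eq,
          EuclideanSpace.real_norm_sq_eq, Fin.sum_univ_three, Fin.sum_univ_three]
        simp
        linear_combination (x 0 ^ 2 + x 1 ^ 2) * Real.sin_sq_add_cos_sq α } rfl

lemma axialRotation_apply (α : ℝ) (x : E3) : axialRotation α x =
    !₂[Real.cos α * x 0 - Real.sin α * x 1, Real.sin α * x 0 + Real.cos α * x 1, x 2] := rfl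

lemma azimuth_axialRotation (m : ℤ) (α : ℝ) (x : S2) :
    azimuth m (sphereMap (axialRotation α) x) =
      Complex.exp (m * (α * Complex.I)) * azimuth m x := by
  unfold azimuth
  simp only [coe_sphereMap, axialRotation_apply]
  split_ifs with h
  · have hm : (m : ℂ) = (m.natAbs : ℂ) := by
      rw [← Int.cast_natCast, Int.natAbs_of_nonneg h]
    rw [hm, Complex.exp_nat_mul, ← mul_pow]
    congr 1
    rw [Complex.exp_mul_I]
    simp
    linear_combination (-(Complex.sin α * x.1 1)) * Complex.I_sq
  · have hm : (m : ℂ) = -(m.natAbs : ℂ) := by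
      rw [← Int.cast_natCast, Int.ofNat_natAbs_of_nonpos (by omega)]; simp
    rw [hm, neg_mul, ← mul_neg, Complex.exp_nat_mul, ← mul_pow]
    congr 1
    rw [← neg_mul, Complex.exp_mul_I]
    simp
    linear_combination (-(Complex.sin α * x.1 1)) * Complex.I_sq

lemma sphHarm_axialRotation (ℓ : ℕ) (m : ℤ) (α : ℝ) (x : S2) :
    sphHarm ℓ m (sphereMap (axialRotation α) x) =
      Complex.exp (m * (α * Complex.I)) * sphHarm ℓ m x := by
  rw [sphHarm_eq, sphHarm_eq, azimuth_axialRotation]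
  simp only [coe_sphereMap, axialRotation_apply]
  simp
  ring

/-- Harmonics of different orders are orthogonal: they transform by different characters under
the rotations about the third axis. -/
lemma integral_sphHarm_of_order_ne {m m' : ℤ} (hm : m ≠ m') (ℓ ℓ' : ℕ) :
    ∫ x, sphHarm ℓ m x * (starRingEnd ℂ) (sphHarm ℓ' m' x) ∂surfaceMeasure = 0 := by
  -- this angle makes the two characters opposite
  set α : ℝ := Real.pi / (m - m') with hα
  have hne : (m : ℝ) - m' ≠ 0 := sub_ne_zero.2 (by exact_mod_cast hm)
  have h := (measurePreserving_sphereMap (axialRotation α)).integral_comp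
    (measurableEmbedding_sphereMap _)
    (fun x => sphHarm ℓ m x * (starRingEnd ℂ) (sphHarm ℓ' m' x))
  simp only [sphHarm_axialRotation] at h
  have hexp : ∀ x, Complex.exp (m * (α * Complex.I)) * sphHarm ℓ m x *
      (starRingEnd ℂ) (Complex.exp (m' * (α * Complex.I)) * sphHarm ℓ' m' x) =
      -(sphHarm ℓ m x * (starRingEnd ℂ) (sphHarm ℓ' m' x)) := by
    intro x
    have : Complex.exp (m * (α * Complex.I)) *
        (starRingEnd ℂ) (Complex.exp (m' * (α * Complex.I))) = -1 := by
      rw [← Complex.exp_conj, ← Complex.exp_add, ← Complex.exp_pi_mul_I]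
      congr 1
      simp only [map_mul, Complex.conj_I, Complex.conj_ofReal, map_intCast]
      have h2 : (Real.pi : ℂ) = (m - m') * α := by
        have : Real.pi = (m - m') * α := by rw [hα]; field_simp
        exact_mod_cast this
      rw [h2]; ring
    rw [map_mul]
    linear_combination (sphHarm ℓ m x * (starRingEnd ℂ) (sphHarm ℓ' m' x)) * this
  simp only [hexp, integral_neg] at h
  exact CharZero.neg_eq_self_iff.1 h

lemma integral_sphHarm_same_order (ℓ ℓ' : ℕ) (m : ℤ) :
    ∫ x, sphHarm ℓ m x * (starRingEnd ℂ) (sphHarm ℓ' m x) ∂surfaceMeasure =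
      ((sphHarmNorm ℓ m.natAbs * sphHarmNorm ℓ' m.natAbs * (2 * Real.pi *
        ∫ t in (-1 : ℝ)..1, ((1 - Polynomial.X ^ 2) ^ m.natAbs *
          Polynomial.derivative^[m.natAbs] (legendrePoly ℓ) *
          Polynomial.derivative^[m.natAbs] (legendrePoly ℓ')).eval t) : ℝ) : ℂ) := by
  rw [← integral_polynomial_height, ← integral_const_mul, ← integral_complex_ofReal]
  refine integral_congr_ae (Eventually.of_forall fun x => ?_)
  simp only [sphHarm_eq, map_mul, Complex.conj_ofReal, star_condonShortley, Polynomial.eval_mul,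
    Polynomial.eval_pow, Polynomial.eval_sub, Polynomial.eval_one, Polynomial.eval_X,
    Complex.ofReal_mul]
  rw [← azimuth_mul_star]
  linear_combination (sphHarmNorm ℓ m.natAbs * sphHarmNorm ℓ' m.natAbs *
    (azimuth m x * (starRingEnd ℂ) (azimuth m x)) *
    (((Polynomial.derivative^[m.natAbs] (legendrePoly ℓ)).eval (x.1 2) : ℝ) : ℂ) *
    (((Polynomial.derivative^[m.natAbs] (legendrePoly ℓ')).eval (x.1 2) : ℝ) : ℂ)) *
    condonShortley_mul_self m

lemma natAbs_le_of_order {ℓ : ℕ} (m : Order ℓ) : (m : ℤ).natAbs ≤ ℓ := by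
  have := Finset.mem_Icc.1 m.2
  omega

lemma integral_sphHarm_self {ℓ : ℕ} (m : Order ℓ) :
    ∫ x, sphHarm ℓ m x * (starRingEnd ℂ) (sphHarm ℓ m x) ∂surfaceMeasure = 1 := by
  rw [integral_sphHarm_same_order, integral_legendrePoly_self (natAbs_le_of_order m),
    sphHarmNorm_sq]
  have : (2 * (ℓ : ℝ) + 1) / (4 * Real.pi) * (((ℓ - (m : ℤ).natAbs).factorial : ℝ) /
      ((ℓ + (m : ℤ).natAbs).factorial : ℝ)) * (2 * Real.pi * (2 / (2 * (ℓ : ℝ) + 1) *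
      (((ℓ + (m : ℤ).natAbs).factorial : ℝ) / ((ℓ - (m : ℤ).natAbs).factorial : ℝ)))) = 1 := by
    have := Real.pi_pos
    field_simp; norm_num
  rw [this]; simp

lemma integral_sphHarm_of_degree_ne {ℓ ℓ' : ℕ} (hℓ : ℓ ≠ ℓ') (m : Order ℓ) (m' : Order ℓ') :
    ∫ x, sphHarm ℓ m x * (starRingEnd ℂ) (sphHarm ℓ' m' x) ∂surfaceMeasure = 0 := by
  by_cases hm : (m : ℤ) = m'
  · have h1 := natAbs_le_of_order m
    have h2 := natAbs_le_of_order m'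
    rw [← hm] at h2 ⊢
    rw [integral_sphHarm_same_order]
    rcases hℓ.lt_or_gt with h | h
    · rw [integral_legendrePoly_of_lt _ h h1]; simp
    · simp only [mul_right_comm _ (Polynomial.derivative^[_] (legendrePoly ℓ)) _]
      rw [integral_legendrePoly_of_lt _ h h2]; simp
  · exact integral_sphHarm_of_order_ne hm ℓ ℓ'

/-- The spherical harmonics indexed by degree and order. -/
noncomputable def harm (i : Σ ℓ : ℕ, Order ℓ) : C(S2, ℂ) :=
  ⟨sphHarm i.1 i.2, continuous_sphHarm _ _⟩

@[simp] lemma harm_apply (i : Σ ℓ : ℕ, Order ℓ) (x : S2) : harm i x = sphHarm i.1 i.2 x := rfl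

open scoped Classical in
lemma integral_harm (i j : Σ ℓ : ℕ, Order ℓ) :
    ∫ x, harm i x * (starRingEnd ℂ) (harm j x) ∂surfaceMeasure = if i = j then 1 else 0 := by
  obtain ⟨ℓ, m⟩ := i
  obtain ⟨ℓ', m'⟩ := j
  by_cases hℓ : ℓ = ℓ'
  · subst hℓ
    by_cases hm : m = m'
    · subst hm
      simpa using integral_sphHarm_self m
    · rw [if_neg (by simpa using hm)]
      exact integral_sphHarm_of_order_ne (fun h => hm (Subtype.ext h)) ℓ ℓ
  · rw [if_neg (fun h => hℓ (congrArg Sigma.fst h))]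
    exact integral_sphHarm_of_degree_ne hℓ m m'

/-! ### The span of the harmonics of bounded degree -/

/-- A coordinate function on the sphere. -/
noncomputable def coordFn (j : Fin 3) : C(S2, ℂ) := ⟨fun x => (x.1 j : ℂ), by fun_prop⟩

@[simp] lemma coordFn_apply (j : Fin 3) (x : S2) : coordFn j x = (x.1 j : ℂ) := rfl

/-- The restrictions to the sphere of the affine functions. -/
noncomputable def affineFns : Submodule ℂ C(S2, ℂ) :=
  Submodule.span ℂ (insert 1 (Set.range coordFn))

lemma one_mem_affineFns : (1 : C(S2, ℂ)) ∈ affineFns := Submodule.subset_span (Set.mem_insert _ _)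

lemma coordFn_mem_affineFns (j : Fin 3) : coordFn j ∈ affineFns :=
  Submodule.subset_span (Set.mem_insert_of_mem _ ⟨j, rfl⟩)

lemma affineFns_pow_mono {a b : ℕ} (h : a ≤ b) : affineFns ^ a ≤ affineFns ^ b :=
  pow_le_pow_right' (Submodule.one_le.2 one_mem_affineFns) h

lemma azimuth_one (x : S2) : azimuth 1 x = (x.1 0 : ℂ) + Complex.I * (x.1 1 : ℂ) := by
  simp [azimuth]

lemma azimuth_neg_one (x : S2) : azimuth (-1) x = (x.1 0 : ℂ) - Complex.I * (x.1 1 : ℂ) := by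
  simp [azimuth]

/-- The azimuthal factor as a continuous function. -/
noncomputable def azim (m : ℤ) : C(S2, ℂ) := ⟨azimuth m, continuous_azimuth m⟩

@[simp] lemma azim_apply (m : ℤ) (x : S2) : azim m x = azimuth m x := rfl

/-- A real polynomial in the height `x₂`. -/
noncomputable def heightPoly (q : Polynomial ℝ) : C(S2, ℂ) :=
  ⟨fun x => ((q.eval (x.1 2) : ℝ) : ℂ),
    Complex.continuous_ofReal.comp (q.continuous.comp (by fun_prop))⟩

@[simp] lemma heightPoly_apply (q : Polynomial ℝ) (x : S2) :
    heightPoly q x = ((q.eval (x.1 2) : ℝ) : ℂ) := rfl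

lemma harm_eq_smul (i : Σ ℓ : ℕ, Order ℓ) : harm i =
    ((sphHarmNorm i.1 (i.2 : ℤ).natAbs : ℂ) * condonShortley i.2) • (azim i.2 *
      heightPoly (Polynomial.derivative^[(i.2 : ℤ).natAbs] (legendrePoly i.1))) := by
  ext x
  simp [sphHarm_eq]

lemma azim_mem (m : ℤ) : azim m ∈ affineFns ^ m.natAbs := by
  have h0 := coordFn_mem_affineFns 0
  have h1 := Submodule.smul_mem _ Complex.I (coordFn_mem_affineFns 1)
  have : azim m = if 0 ≤ m then (coordFn 0 + Complex.I • coordFn 1) ^ m.natAbs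
      else (coordFn 0 - Complex.I • coordFn 1) ^ m.natAbs := by
    ext x
    simp only [azim_apply, azimuth]
    split_ifs <;> simp
  rw [this]
  split_ifs
  · exact Submodule.pow_mem_pow _ (add_mem h0 h1) _
  · exact Submodule.pow_mem_pow _ (sub_mem h0 h1) _

lemma heightPoly_mem {q : Polynomial ℝ} {n : ℕ} (hq : q.natDegree ≤ n) :
    heightPoly q ∈ affineFns ^ n := by
  have : heightPoly q = ∑ k ∈ Finset.range (n + 1), (q.coeff k : ℂ) • coordFn 2 ^ k := by
    ext x
    simp [Polynomial.eval_eq_sum_range' (Nat.lt_succ_of_le hq)]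
  rw [this]
  refine Submodule.sum_mem _ fun k hk => Submodule.smul_mem _ _ ?_
  exact affineFns_pow_mono (Nat.lt_succ_iff.1 (Finset.mem_range.1 hk))
    (Submodule.pow_mem_pow _ (coordFn_mem_affineFns 2) _)

/-- The span of the spherical harmonics of degree at most `L`. -/
noncomputable def harmSpan (L : ℕ) : Submodule ℂ C(S2, ℂ) :=
  Submodule.span ℂ (harm '' {i | i.1 ≤ L})

lemma harmSpan_mono {L L' : ℕ} (h : L ≤ L') : harmSpan L ≤ harmSpan L' :=
  Submodule.span_mono (Set.image_mono fun _ hi => le_trans hi h)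

lemma harm_mem_affineFns_pow (i : Σ ℓ : ℕ, Order ℓ) : harm i ∈ affineFns ^ i.1 := by
  rw [harm_eq_smul]
  refine Submodule.smul_mem _ _ ?_
  have hm := natAbs_le_of_order i.2
  have := Submodule.mul_mem_mul (azim_mem i.2)
    (heightPoly_mem (natDegree_iterate_derivative_legendrePoly_le i.1 (i.2 : ℤ).natAbs))
  rwa [← pow_add, Nat.add_sub_cancel' hm] at this

lemma harmSpan_le_affineFns_pow (L : ℕ) : harmSpan L ≤ affineFns ^ L := by
  refine Submodule.span_le.2 ?_
  rintro _ ⟨i, hi, rfl⟩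
  exact affineFns_pow_mono hi (harm_mem_affineFns_pow i)

lemma azim_mul_legendre_mem (m : ℤ) {ℓ : ℕ} (hm : m.natAbs ≤ ℓ) :
    azim m * heightPoly (Polynomial.derivative^[m.natAbs] (legendrePoly ℓ)) ∈ harmSpan ℓ := by
  have hm' : m ∈ Finset.Icc (-(ℓ : ℤ)) ℓ := by rw [Finset.mem_Icc]; omega
  have h := Submodule.subset_span (R := ℂ)
    (Set.mem_image_of_mem harm
      (show (⟨ℓ, ⟨m, hm'⟩⟩ : Σ ℓ : ℕ, Order ℓ) ∈ {i | i.1 ≤ ℓ} from le_refl ℓ))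
  change _ ∈ harmSpan ℓ at h
  rw [harm_eq_smul] at h
  refine (Submodule.smul_mem_iff _ (mul_ne_zero ?_ ?_)).1 h
  · exact_mod_cast (sphHarmNorm_pos _ _).ne'
  · intro h0
    have := condonShortley_mul_self m
    simp only [h0] at this
    simp at this

/-- For fixed `m` the derivatives `P_ℓ^(|m|)`, `ℓ ≥ |m|`, have degrees `0, 1, 2, …`, so they span
all polynomials. -/
lemma azim_mul_heightPoly_mem_of_degree_lt (m : ℤ) (d : ℕ) (q : Polynomial ℝ)
    (hq : q.degree < d) {L : ℕ} (hL : m.natAbs + d ≤ L + 1) :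
    azim m * heightPoly q ∈ harmSpan L := by
  induction d generalizing q with
  | zero =>
    have : q = 0 := by simpa using hq
    subst this
    have : azim m * heightPoly 0 = 0 := by ext x; simp
    rw [this]; exact zero_mem _
  | succ d ih =>
    set p := Polynomial.derivative^[m.natAbs] (legendrePoly (m.natAbs + d)) with hp
    have hpd : p.natDegree ≤ d := by
      simpa using natDegree_iterate_derivative_legendrePoly_le (m.natAbs + d) m.natAbs
    have hpc : p.coeff d ≠ 0 := by
      have := coeff_iterate_derivative_legendrePoly (Nat.le_add_right m.natAbs d)
      rw [Nat.add_sub_cancel_left] at this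
      rw [hp, this]
      positivity
    set c := q.coeff d / p.coeff d with hc
    have hlt : (q - Polynomial.C c * p).degree < d := by
      rw [Polynomial.degree_lt_iff_coeff_zero] at hq ⊢
      intro k hk
      rw [Polynomial.coeff_sub, Polynomial.coeff_C_mul]
      rcases hk.eq_or_lt with rfl | hk
      · rw [hc, div_mul_cancel₀ _ hpc, sub_self]
      · rw [hq k (by omega), Polynomial.coeff_eq_zero_of_natDegree_lt (by omega)]; simp
    have h1 := ih (q - Polynomial.C c * p) hlt (by omega)
    have h2 := Submodule.smul_mem _ (c : ℂ) (harmSpan_mono (show m.natAbs + d ≤ L by omega)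
      (azim_mul_legendre_mem m (Nat.le_add_right m.natAbs d)))
    convert add_mem h1 h2 using 1
    ext x
    simp [← hp]
    ring

lemma azim_mul_heightPoly_mem (m : ℤ) {q : Polynomial ℝ} {L : ℕ}
    (h : m.natAbs + q.natDegree ≤ L) : azim m * heightPoly q ∈ harmSpan L :=
  azim_mul_heightPoly_mem_of_degree_lt m (q.natDegree + 1) q
    (Polynomial.degree_le_natDegree.trans_lt (by exact_mod_cast Nat.lt_succ_self _)) (by omega)

lemma natDegree_one_sub_X_sq_le : (1 - Polynomial.X ^ 2 : Polynomial ℝ).natDegree ≤ 2 := by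
  compute_degree

/-- Multiplication by `x₀ ± i x₁` raises the degree by at most one. -/
lemma azim_mul_heightPoly_mul_azim_mem {m : ℤ} {q : Polynomial ℝ} {L : ℕ}
    (h : m.natAbs + q.natDegree ≤ L) {s : ℤ} (hs : s = 1 ∨ s = -1) :
    azim m * heightPoly q * azim s ∈ harmSpan (L + 1) := by
  have hw : ∀ x : S2, (1 : ℂ) - (x.1 2 : ℂ) ^ 2 = (x.1 0 : ℂ) ^ 2 + (x.1 1 : ℂ) ^ 2 := by
    intro x
    have := sum_sq_coord x
    have : (1 : ℝ) - x.1 2 ^ 2 = x.1 0 ^ 2 + x.1 1 ^ 2 := by linarith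
    exact_mod_cast this
  -- either the orders have the same sign, or a factor `(x₀ + i x₁)(x₀ - i x₁) = 1 - x₂²` appears
  by_cases hsgn : (m + s).natAbs = m.natAbs + 1
  · have : azim m * heightPoly q * azim s = azim (m + s) * heightPoly q := by
      ext x
      simp only [ContinuousMap.mul_apply, azim_apply, heightPoly_apply]
      rw [mul_right_comm]
      congr 1
      unfold azimuth
      rw [hsgn]
      rcases hs with rfl | rfl
      · rw [if_pos (by omega), if_pos (by omega), if_pos (by omega)]
        simp [pow_succ]
      · rw [if_neg (show ¬ (0 : ℤ) ≤ -1 by omega), if_neg (show ¬ (0 : ℤ) ≤ m + -1 by omega)]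
        split_ifs with h0
        · have : m = 0 := by omega
          subst this; simp
        · simp [pow_succ]
    rw [this]
    exact azim_mul_heightPoly_mem _ (by omega)
  · obtain ⟨k, hk⟩ : ∃ k, m.natAbs = k + 1 := ⟨m.natAbs - 1, by omega⟩
    have hk' : (m + s).natAbs = k := by omega
    have : azim m * heightPoly q * azim s =
        azim (m + s) * heightPoly (q * (1 - Polynomial.X ^ 2)) := by
      ext x
      simp only [ContinuousMap.mul_apply, azim_apply, heightPoly_apply]
      unfold azimuth
      rw [hk, hk']
      simp only [Polynomial.eval_mul, Polynomial.eval_sub, Polynomial.eval_one,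
        Polynomial.eval_pow, Polynomial.eval_X]
      push_cast
      rw [hw x, pow_succ]
      rcases hs with rfl | rfl
      · rw [if_neg (show ¬ (0 : ℤ) ≤ m by omega), if_pos (show (0 : ℤ) ≤ 1 by omega)]
        split_ifs with h0
        · have : k = 0 := by omega
          subst this
          simp
          linear_combination
            (-(((q.eval (x.1 2) : ℝ) : ℂ) * (x.1 1 : ℂ) ^ 2)) * Complex.I_sq
        · simp
          linear_combination
            (-(((x.1 0 : ℂ) - Complex.I * (x.1 1 : ℂ)) ^ k * ((q.eval (x.1 2) : ℝ) : ℂ) *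
              (x.1 1 : ℂ) ^ 2)) * Complex.I_sq
      · rw [if_pos (show (0 : ℤ) ≤ m by omega), if_neg (show ¬ (0 : ℤ) ≤ -1 by omega),
          if_pos (show (0 : ℤ) ≤ m + -1 by omega)]
        simp
        linear_combination
            (-(((x.1 0 : ℂ) + Complex.I * (x.1 1 : ℂ)) ^ k * ((q.eval (x.1 2) : ℝ) : ℂ) *
              (x.1 1 : ℂ) ^ 2)) * Complex.I_sq
    rw [this]
    refine azim_mul_heightPoly_mem _ ?_
    have := Polynomial.natDegree_mul_le_of_le (le_refl q.natDegree) natDegree_one_sub_X_sq_le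
    omega

lemma harmSpan_mul_affineFns_le (L : ℕ) : harmSpan L * affineFns ≤ harmSpan (L + 1) := by
  rw [harmSpan, affineFns, Submodule.span_mul_span, Submodule.span_le]
  rintro _ ⟨_, ⟨i, hi, rfl⟩, g, hg, rfl⟩
  have hi : i.1 ≤ L := hi
  simp only [SetLike.mem_coe]
  rw [harm_eq_smul, smul_mul_assoc]
  refine Submodule.smul_mem _ _ ?_
  set m : ℤ := (i.2 : ℤ)
  have hm : m.natAbs ≤ i.1 := natAbs_le_of_order i.2
  set q := Polynomial.derivative^[m.natAbs] (legendrePoly i.1)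
  have hq : q.natDegree ≤ i.1 - m.natAbs := natDegree_iterate_derivative_legendrePoly_le _ _
  have hd : m.natAbs + q.natDegree ≤ L := by omega
  have hp := azim_mul_heightPoly_mul_azim_mem hd (Or.inl rfl)
  have hn := azim_mul_heightPoly_mul_azim_mem hd (Or.inr rfl)
  rcases Set.mem_insert_iff.1 hg with rfl | ⟨j, rfl⟩
  · rw [mul_one]; exact azim_mul_heightPoly_mem m (by omega)
  · fin_cases j
    · convert Submodule.smul_mem _ (1 / 2 : ℂ) (add_mem hp hn) using 1
      ext x
      simp [azimuth_one, azimuth_neg_one]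
      ring
    · convert Submodule.smul_mem _ (-Complex.I / 2 : ℂ) (sub_mem hp hn) using 1
      ext x
      simp [azimuth_one, azimuth_neg_one]
      linear_combination (azimuth m x * ((q.eval (x.1 2) : ℝ) : ℂ) * (x.1 1 : ℂ)) * Complex.I_sq
    · convert azim_mul_heightPoly_mem m (q := q * Polynomial.X) (L := L + 1) ?_ using 1
      · ext x
        simp
        ring
      · have := Polynomial.natDegree_mul_le_of_le (le_refl q.natDegree)
          (Polynomial.natDegree_X_le (R := ℝ))
        omega

/-- The harmonics of degree at most `L` span the restrictions of the polynomials of degree at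
most `L`. -/
lemma harmSpan_eq_affineFns_pow (L : ℕ) : harmSpan L = affineFns ^ L := by
  refine le_antisymm (harmSpan_le_affineFns_pow L) ?_
  induction L with
  | zero =>
    rw [Submodule.pow_zero, Submodule.one_le]
    convert azim_mul_heightPoly_mem 0 (q := 1) (L := 0) (by simp) using 1
    ext x
    simp [azimuth]
  | succ L ih =>
    rw [Submodule.pow_succ]
    exact (mul_le_mul' ih le_rfl).trans (harmSpan_mul_affineFns_le L)

/-- Composition with an isometry, as an algebra homomorphism. -/
noncomputable def compIsometry (e : E3 ≃ₗᵢ[ℝ] E3) : C(S2, ℂ) →ₐ[ℂ] C(S2, ℂ) :=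
  ContinuousMap.compRightAlgHom ℂ ℂ ⟨sphereMap e, continuous_sphereMap e⟩

@[simp] lemma compIsometry_apply (e : E3 ≃ₗᵢ[ℝ] E3) (f : C(S2, ℂ)) (x : S2) :
    compIsometry e f x = f (sphereMap e x) := rfl

lemma map_affineFns_le (e : E3 ≃ₗᵢ[ℝ] E3) :
    affineFns.map (compIsometry e).toLinearMap ≤ affineFns := by
  rw [affineFns, Submodule.map_span, Submodule.span_le]
  rintro _ ⟨g, hg, rfl⟩
  change compIsometry e g ∈ affineFns
  rcases Set.mem_insert_iff.1 hg with rfl | ⟨j, rfl⟩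
  · rw [map_one]; exact one_mem_affineFns
  · have : compIsometry e (coordFn j) =
        ∑ k, ((e (EuclideanSpace.single k 1) j : ℝ) : ℂ) • coordFn k := by
      ext x
      have hx : x.1 = ∑ k, x.1 k • EuclideanSpace.single k (1 : ℝ) := by
        simpa using ((EuclideanSpace.basisFun (Fin 3) ℝ).sum_repr x.1).symm
      simp only [compIsometry_apply, coordFn_apply, coe_sphereMap]
      conv_lhs => rw [hx, map_sum]
      simp [mul_comm]
    rw [this]
    exact Submodule.sum_mem _ fun k _ => Submodule.smul_mem _ _ (coordFn_mem_affineFns k)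

lemma comp_mem_harmSpan (e : E3 ≃ₗᵢ[ℝ] E3) {L : ℕ} {f : C(S2, ℂ)} (hf : f ∈ harmSpan L) :
    compIsometry e f ∈ harmSpan L := by
  rw [harmSpan_eq_affineFns_pow] at hf ⊢
  have h : (affineFns ^ L).map (compIsometry e).toLinearMap ≤ affineFns ^ L := by
    rw [Submodule.map_pow]
    exact pow_le_pow_left' (map_affineFns_le e) L
  exact h (Submodule.mem_map_of_mem hf)

/-- Stone-Weierstrass: the spherical harmonics span a uniformly dense subspace. -/
lemma dense_iUnion_harmSpan : Dense (⋃ L, (harmSpan L : Set C(S2, ℂ))) := by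
  set A : StarSubalgebra ℂ C(S2, ℂ) := StarAlgebra.adjoin ℂ (Set.range coordFn) with hA
  have hstar : star (Set.range coordFn) = Set.range coordFn := by
    have h : ∀ j, star (coordFn j) = coordFn j := fun j => by ext x; simp
    ext f
    rw [Set.mem_star]
    constructor
    · rintro ⟨j, hj⟩; exact ⟨j, by rw [← star_star f, ← hj, h]⟩
    · rintro ⟨j, rfl⟩; exact ⟨j, (h j).symm⟩
  have hle : (A : Set C(S2, ℂ)) ⊆ ⋃ L, (harmSpan L : Set C(S2, ℂ)) := by
    intro f hf
    have hf' : f ∈ Algebra.adjoin ℂ (Set.range coordFn) := by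
      have h2 : f ∈ A.toSubalgebra := hf
      rwa [hA, StarAlgebra.adjoin_toSubalgebra, hstar, Set.union_self] at h2
    simp only [harmSpan_eq_affineFns_pow, Set.mem_iUnion, SetLike.mem_coe]
    clear hf
    induction hf' using Algebra.adjoin_induction with
    | mem x hx =>
      obtain ⟨j, rfl⟩ := hx
      exact ⟨1, by rw [Submodule.pow_one]; exact coordFn_mem_affineFns j⟩
    | algebraMap r =>
      refine ⟨0, ?_⟩
      rw [Submodule.pow_zero]; exact Submodule.algebraMap_mem r
    | add x y _ _ hx hy =>
      obtain ⟨a, ha⟩ := hx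
      obtain ⟨b, hb⟩ := hy
      exact ⟨max a b, add_mem (affineFns_pow_mono (le_max_left a b) ha)
        (affineFns_pow_mono (le_max_right a b) hb)⟩
    | mul x y _ _ hx hy =>
      obtain ⟨a, ha⟩ := hx
      obtain ⟨b, hb⟩ := hy
      have h := Submodule.mul_mem_mul ha hb
      rw [← pow_add] at h
      exact ⟨a + b, h⟩
  have hsep : A.SeparatesPoints := by
    intro x y hxy
    by_contra! hcon
    apply hxy
    ext j
    have := hcon (coordFn j) ⟨coordFn j, StarAlgebra.subset_adjoin ℂ _ ⟨j, rfl⟩, rfl⟩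
    simpa using this
  have htop := ContinuousMap.starSubalgebra_topologicalClosure_eq_top_of_separatesPoints A hsep
  refine Dense.mono hle ?_
  rw [dense_iff_closure_eq, ← StarSubalgebra.topologicalClosure_coe, htop]
  rfl

/-! ### Expansions in `L²(S²)` -/

/-- The spherical harmonics as elements of `L²(S²)`. -/
noncomputable def harmLp (i : Σ ℓ : ℕ, Order ℓ) : Lp ℂ 2 surfaceMeasure :=
  ContinuousMap.toLp 2 surfaceMeasure ℂ (harm i)

lemma inner_harmLp_toLp (i : Σ ℓ : ℕ, Order ℓ) (f : C(S2, ℂ)) :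
    ⟪harmLp i, ContinuousMap.toLp 2 surfaceMeasure ℂ f⟫_ℂ =
      ∫ x, f x * (starRingEnd ℂ) (harm i x) ∂surfaceMeasure :=
  ContinuousMap.inner_toLp surfaceMeasure (harm i) f

lemma orthonormal_harmLp : Orthonormal ℂ harmLp := by
  classical
  rw [orthonormal_iff_ite]
  intro i j
  rw [harmLp, harmLp, ContinuousMap.inner_toLp, integral_harm]
  simp only [eq_comm]

lemma span_harmLp_dense : ⊤ ≤ (Submodule.span ℂ (Set.range harmLp)).topologicalClosure := by
  have h : Dense (Submodule.span ℂ (Set.range harmLp) : Set (Lp ℂ 2 surfaceMeasure)) := by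
    have h1 := (ContinuousMap.toLp_denseRange ℂ surfaceMeasure ℂ (p := 2)
      (by norm_num)).dense_image (ContinuousLinearMap.continuous _) dense_iUnion_harmSpan
    refine h1.mono ?_
    rintro _ ⟨f, hf, rfl⟩
    obtain ⟨L, hL⟩ := Set.mem_iUnion.1 hf
    have h2 := Submodule.mem_map_of_mem
      (f := (ContinuousMap.toLp 2 surfaceMeasure ℂ : C(S2, ℂ) →L[ℂ] _).toLinearMap) hL
    rw [harmSpan, Submodule.map_span] at h2
    refine Submodule.span_mono ?_ h2
    rintro _ ⟨_, ⟨i, _, rfl⟩, rfl⟩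
    exact ⟨i, rfl⟩
  rw [← SetLike.coe_subset_coe, Submodule.topologicalClosure_coe, h.closure_eq]
  simp

/-- Elements of the span of the harmonics of degree at most `L` have finite expansions, whose
coefficients are inner products. -/
lemma exists_finsupp_of_mem_harmSpan {L : ℕ} {f : C(S2, ℂ)} (hf : f ∈ harmSpan L) :
    ∃ c : (Σ ℓ : ℕ, Order ℓ) →₀ ℂ, (∀ i, c i ≠ 0 → i.1 ≤ L) ∧
      Finsupp.linearCombination ℂ harm c = f ∧
      ∀ i, c i = ∫ x, f x * (starRingEnd ℂ) (harm i x) ∂surfaceMeasure := by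
  obtain ⟨c, hc, rfl⟩ := (Finsupp.mem_span_image_iff_linearCombination ℂ).1 hf
  refine ⟨c, fun i hi => (Finsupp.mem_supported ℂ c).1 hc (Finsupp.mem_support_iff.2 hi), rfl,
    fun i => ?_⟩
  rw [← inner_harmLp_toLp, ← orthonormal_harmLp.inner_right_finsupp c i]
  congr 1
  exact (Finsupp.apply_linearCombination ℂ
    (ContinuousMap.toLp 2 surfaceMeasure ℂ : C(S2, ℂ) →L[ℂ] _).toLinearMap harm c).symm

lemma integral_harmSpan_of_lt {L : ℕ} {f : C(S2, ℂ)} (hf : f ∈ harmSpan L)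
    {i : Σ ℓ : ℕ, Order ℓ} (hi : L < i.1) :
    ∫ x, f x * (starRingEnd ℂ) (harm i x) ∂surfaceMeasure = 0 := by
  obtain ⟨c, h1, -, h3⟩ := exists_finsupp_of_mem_harmSpan hf
  rw [← h3]
  by_contra h
  exact absurd (h1 i h) (not_le.2 hi)

/-- A rotated harmonic is orthogonal to all harmonics of other degrees: the polynomials of degree
at most `L` are invariant under isometries, hence so is the orthogonal complement of those of
degree less than `L` therein. -/
lemma integral_comp_isometry_of_degree_ne (e : E3 ≃ₗᵢ[ℝ] E3) {i j : Σ ℓ : ℕ, Order ℓ}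
    (hij : i.1 ≠ j.1) :
    ∫ x, harm i (sphereMap e x) * (starRingEnd ℂ) (harm j x) ∂surfaceMeasure = 0 := by
  have hmem : ∀ (e : E3 ≃ₗᵢ[ℝ] E3) (k : Σ ℓ : ℕ, Order ℓ),
      compIsometry e (harm k) ∈ harmSpan k.1 := fun e k =>
    comp_mem_harmSpan e (Submodule.subset_span ⟨k, le_refl k.1, rfl⟩)
  rcases hij.lt_or_gt with h | h
  · exact integral_harmSpan_of_lt (hmem e i) h
  · have h1 := integral_harmSpan_of_lt (hmem e.symm j) h
    have h2 := (measurePreserving_sphereMap e).integral_comp (measurableEmbedding_sphereMap e)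
      (fun x => compIsometry e.symm (harm j) x * (starRingEnd ℂ) (harm i x))
    rw [h1] at h2
    have h3 : ∀ x, sphereMap e.symm (sphereMap e x) = x := fun x => Subtype.ext (by simp)
    simp only [compIsometry_apply, h3] at h2
    have h4 := congrArg (starRingEnd ℂ) h2
    rw [← integral_conj, map_zero] at h4
    rw [← h4]
    refine integral_congr_ae (Eventually.of_forall fun x => ?_)
    simp [mul_comm]

/-- The defining relation of the Wigner matrices. -/
lemma sphHarm_rotate (ℓ : ℕ) (m : Order ℓ) (ρ : Rot3) (x : S2) :
    sphHarm ℓ m (rotate ρ⁻¹ x) = ∑ m' : Order ℓ, wignerD ℓ ρ m' m * sphHarm ℓ m' x := by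
  set e : E3 ≃ₗᵢ[ℝ] E3 := ((ρ⁻¹ : Rot3) : E3 ≃ₗᵢ[ℝ] E3) with he
  obtain ⟨c, -, h2, h3⟩ := exists_finsupp_of_mem_harmSpan
    (comp_mem_harmSpan e (Submodule.subset_span ⟨⟨ℓ, m⟩, le_refl ℓ, rfl⟩))
  have hsupp : c.support ⊆ Finset.univ.map (Function.Embedding.sigmaMk (β := Order) ℓ) := by
    rintro ⟨k, n⟩ hkn
    have hk : ℓ = k := by
      by_contra hne
      refine (Finsupp.mem_support_iff.1 hkn) ?_
      rw [h3]
      exact integral_comp_isometry_of_degree_ne e (i := ⟨ℓ, m⟩) (j := ⟨k, n⟩) hne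
    subst hk
    simp
  have h4 := congrArg (fun f : C(S2, ℂ) => f x) h2
  simp only [Finsupp.linearCombination_apply] at h4
  rw [Finsupp.sum_of_support_subset c hsupp _ (by simp), Finset.sum_map] at h4
  have h5 : sphHarm ℓ m (rotate ρ⁻¹ x) = compIsometry e (harm ⟨ℓ, m⟩) x := rfl
  rw [h5, ← h4, ContinuousMap.sum_apply]
  refine Finset.sum_congr rfl fun m' _ => ?_
  rw [h3]
  rfl

/-- The part of degree at most `L` of the expansion of a function on the sphere. -/
noncomputable def harmSum (f : S2 → ℂ) (L : ℕ) (x : S2) : ℂ :=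
  ∑ ℓ ∈ Finset.range (L + 1), ∑ m : Order ℓ,
    (∫ y, f y * (starRingEnd ℂ) (sphHarm ℓ m y) ∂surfaceMeasure) * sphHarm ℓ m x

lemma inner_harmLp_memLp_toLp (i : Σ ℓ : ℕ, Order ℓ) {f : S2 → ℂ}
    (hf : MemLp f 2 surfaceMeasure) :
    ⟪harmLp i, hf.toLp f⟫_ℂ = ∫ x, f x * (starRingEnd ℂ) (harm i x) ∂surfaceMeasure := by
  rw [L2.inner_def]
  refine integral_congr_ae ?_
  filter_upwards [hf.coeFn_toLp, (harm i).coeFn_toLp (p := 2) (𝕜 := ℂ) surfaceMeasure]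
    with x h1 h2
  rw [h1, harmLp, h2]
  rfl

/-- The indices of the harmonics of degree at most `L`. -/
noncomputable def degreeLE (L : ℕ) : Finset (Σ ℓ : ℕ, Order ℓ) :=
  (Finset.range (L + 1)).sigma fun _ => Finset.univ

lemma eLpNorm_sub_harmSum {f : S2 → ℂ} (hf : MemLp f 2 surfaceMeasure) (L : ℕ) :
    eLpNorm (fun x => f x - harmSum f L x) 2 surfaceMeasure =
      ‖hf.toLp f - ∑ i ∈ degreeLE L, ⟪harmLp i, hf.toLp f⟫_ℂ • harmLp i‖ₑ := by
  set g : C(S2, ℂ) := ∑ i ∈ degreeLE L, ⟪harmLp i, hf.toLp f⟫_ℂ • harm i with hg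
  have h1 : ∑ i ∈ degreeLE L, ⟪harmLp i, hf.toLp f⟫_ℂ • harmLp i =
      ContinuousMap.toLp 2 surfaceMeasure ℂ g := by
    rw [hg, map_sum]
    simp only [map_smul]
    rfl
  have h2 : ∀ x, harmSum f L x = g x := by
    intro x
    rw [hg, ContinuousMap.sum_apply, degreeLE, Finset.sum_sigma, harmSum]
    refine Finset.sum_congr rfl fun ℓ _ => Finset.sum_congr rfl fun m _ => ?_
    rw [inner_harmLp_memLp_toLp]
    rfl
  rw [h1, Lp.enorm_def]
  refine eLpNorm_congr_ae ?_
  filter_upwards [hf.coeFn_toLp, g.coeFn_toLp (p := 2) (𝕜 := ℂ) surfaceMeasure,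
    Lp.coeFn_sub (hf.toLp f) (ContinuousMap.toLp 2 surfaceMeasure ℂ g)] with x e1 e2 e3
  rw [e3, Pi.sub_apply, e1, e2, h2]

/-- The harmonic expansion converges in `L²(S²)`. -/
lemma tendsto_eLpNorm_sub_harmSum {f : S2 → ℂ} (hf : MemLp f 2 surfaceMeasure) :
    Tendsto (fun L => eLpNorm (fun x => f x - harmSum f L x) 2 surfaceMeasure) atTop (𝓝 0) := by
  simp only [eLpNorm_sub_harmSum hf]
  have h := (HilbertBasis.mk orthonormal_harmLp span_harmLp_dense).hasSum_repr (hf.toLp f)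
  simp only [HilbertBasis.repr_apply_apply, HilbertBasis.coe_mk] at h
  have hmono : Tendsto degreeLE atTop atTop := by
    refine tendsto_atTop_finset_of_monotone ?_ ?_
    · intro a b hab
      exact Finset.sigma_mono (Finset.range_mono (by omega)) fun _ => le_rfl
    · intro i
      exact ⟨i.1, by simp [degreeLE]⟩
  have h2 := (tendsto_const_nhds (x := hf.toLp f)).sub (h.comp hmono)
  rw [sub_self] at h2
  have h3 := h2.enorm
  rwa [enorm_zero] at h3

lemma eLpNorm_sub_harmSum_le {f : S2 → ℂ} (hf : MemLp f 2 surfaceMeasure) (L : ℕ) :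
    eLpNorm (fun x => f x - harmSum f L x) 2 surfaceMeasure ≤
      2 * eLpNorm f 2 surfaceMeasure := by
  rw [eLpNorm_sub_harmSum hf, ← Lp.enorm_toLp hf]
  have hle : ‖∑ i ∈ degreeLE L, ⟪harmLp i, hf.toLp f⟫_ℂ • harmLp i‖ ≤ ‖hf.toLp f‖ := by
    refine le_of_sq_le_sq ?_ (norm_nonneg _)
    refine le_trans (le_of_eq ?_)
      (orthonormal_harmLp.sum_inner_products_le (hf.toLp f) (s := degreeLE L))
    have h := orthonormal_harmLp.inner_sum (fun i => ⟪harmLp i, hf.toLp f⟫_ℂ)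
      (fun i => ⟪harmLp i, hf.toLp f⟫_ℂ) (degreeLE L)
    rw [inner_self_eq_norm_sq_to_K] at h
    simp only [RCLike.conj_mul] at h
    exact_mod_cast h
  calc _ ≤ ‖hf.toLp f‖ₑ + ‖∑ i ∈ degreeLE L, ⟪harmLp i, hf.toLp f⟫_ℂ • harmLp i‖ₑ :=
        enorm_sub_le
    _ ≤ ‖hf.toLp f‖ₑ + ‖hf.toLp f‖ₑ := by
        gcongr
        exact enorm_le_iff_norm_le.2 hle
    _ = _ := (two_mul _).symm

/-! ### Transitivity of the rotation group on the sphere -/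

/-- The half-turn about the axis spanned by a nonzero vector. -/
noncomputable def halfTurn (v : E3) (hv : v ≠ 0) : Rot3 :=
  ⟨(ℝ ∙ v).reflection, by
    have hfact : Fact (Module.finrank ℝ E3 = 2 + 1) := ⟨by simp⟩
    have h := Submodule.det_reflection (K := ℝ ∙ v)
    rw [Submodule.finrank_orthogonal_span_singleton (n := 2) hv] at h
    exact h.trans (by norm_num)⟩

lemma coe_rotate_halfTurn (v : E3) (hv : v ≠ 0) (x : S2) :
    (rotate (halfTurn v hv) x : E3) = (2 : ℝ) • (⟪v, x.1⟫_ℝ / ‖v‖ ^ 2) • v - x.1 := by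
  have h := Submodule.reflection_singleton_apply (𝕜 := ℝ) v x.1
  rw [ofNat_smul_eq_nsmul ℝ 2]
  exact h

lemma exists_rotate_eq (x y : S2) : ∃ ρ : Rot3, rotate ρ x = y := by
  have hx : ‖x.1‖ = 1 := by simp
  have hy : ‖y.1‖ = 1 := by simp
  by_cases h : x.1 + y.1 = 0
  -- antipodal points are exchanged by any half-turn about a perpendicular axis
  · have hfact : Fact (Module.finrank ℝ E3 = 2 + 1) := ⟨by simp⟩
    have hx0 : x.1 ≠ 0 := by rw [← norm_ne_zero_iff, hx]; exact one_ne_zero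
    have hdim := Submodule.finrank_orthogonal_span_singleton (𝕜 := ℝ) (n := 2) hx0
    have hbot : (ℝ ∙ x.1)ᗮ ≠ ⊥ := by
      intro hb
      rw [hb, finrank_bot] at hdim
      omega
    obtain ⟨v, hv, hv0⟩ := Submodule.exists_mem_ne_zero_of_ne_bot hbot
    refine ⟨halfTurn v hv0, Subtype.ext ?_⟩
    rw [coe_rotate_halfTurn, real_inner_comm,
      Submodule.mem_orthogonal_singleton_iff_inner_right.1 hv]
    simpa using (eq_neg_of_add_eq_zero_right h).symm
  -- otherwise the half-turn about the bisector does it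
  · refine ⟨halfTurn _ h, Subtype.ext ?_⟩
    have h1 : ‖x.1 + y.1‖ ^ 2 = 2 * ⟪x.1 + y.1, x.1⟫_ℝ := by
      rw [norm_add_sq_real, inner_add_left, real_inner_self_eq_norm_sq, hx, hy,
        real_inner_comm x.1 y.1]
      ring
    have h2 : ‖x.1 + y.1‖ ^ 2 ≠ 0 := pow_ne_zero _ (norm_ne_zero_iff.2 h)
    rw [coe_rotate_halfTurn, smul_smul, ← mul_div_assoc, ← h1, div_self h2, one_smul]
    simp

/-! ### Partial sums of the expansion of a random field -/

lemma conj_sphHarm (ℓ : ℕ) (m : ℤ) (x : S2) :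
    (starRingEnd ℂ) (sphHarm ℓ m x) = (-1) ^ m.natAbs * sphHarm ℓ (-m) x := by
  have hsq : ((-1 : ℂ) ^ m.natAbs) * (-1) ^ m.natAbs = 1 := by rw [← mul_pow]; simp
  unfold sphHarm
  simp only [Int.natAbs_neg, Int.neg_nonneg]
  rcases lt_trichotomy m 0 with h | rfl | h
  · rw [if_neg (by omega), if_pos (by omega)]
    simp only [map_mul, map_pow, map_sub, Complex.conj_I, Complex.conj_ofReal]
    rw [neg_mul, sub_neg_eq_add]
    linear_combination (-(((Real.sqrt ((2 * (ℓ : ℝ) + 1) / (4 * Real.pi) *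
      (((ℓ - m.natAbs).factorial : ℝ) / ((ℓ + m.natAbs).factorial : ℝ))) : ℂ) *
      ((x.1 0 : ℂ) + Complex.I * (x.1 1 : ℂ)) ^ m.natAbs *
    (((Polynomial.derivative^[m.natAbs] (legendrePoly ℓ)).eval (x.1 2) : ℝ) : ℂ)))) * hsq
  · simp
  · rw [if_pos (by omega), if_neg (by omega)]
    simp only [map_mul, map_pow, map_add, map_neg, map_one, Complex.conj_I, Complex.conj_ofReal]
    rw [neg_mul, ← sub_eq_add_neg]
    ring

section RandomField

variable {Ω : Type*}

/-- The degree `ℓ` part of the expansion of a field. -/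
noncomputable def levelSum (T : Ω → S2 → ℝ) (ℓ : ℕ) (x : S2) (ω : Ω) : ℂ :=
  ∑ m : Order ℓ, coeffBlock T ℓ ω m * sphHarm ℓ m x

lemma partialSum_eq_sum_levelSum (T : Ω → S2 → ℝ) (L : ℕ) (x : S2) (ω : Ω) :
    partialSum T L x ω = ∑ ℓ ∈ Finset.range (L + 1), levelSum T ℓ x ω := rfl

/-- The order `-m`. -/
def Order.neg {ℓ : ℕ} (m : Order ℓ) : Order ℓ :=
  ⟨-m, by have := Finset.mem_Icc.1 m.2; rw [Finset.mem_Icc]; omega⟩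

lemma Order.neg_neg {ℓ : ℕ} (m : Order ℓ) : m.neg.neg = m := Subtype.ext (by simp [Order.neg])

lemma conj_coeffBlock (T : Ω → S2 → ℝ) (ℓ : ℕ) (ω : Ω) (m : Order ℓ) :
    (starRingEnd ℂ) (coeffBlock T ℓ ω m) =
      (-1) ^ (m : ℤ).natAbs * coeffBlock T ℓ ω m.neg := by
  unfold coeffBlock
  rw [← integral_conj, ← integral_const_mul]
  refine integral_congr_ae (Eventually.of_forall fun x => ?_)
  simp only [map_mul, Complex.conj_ofReal, Complex.conj_conj]
  have h := conj_sphHarm ℓ (m.neg : ℤ) x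
  simp only [Order.neg, Int.natAbs_neg, _root_.neg_neg] at h ⊢
  rw [h]
  have hsq : ((-1 : ℂ) ^ (m : ℤ).natAbs) * (-1) ^ (m : ℤ).natAbs = 1 := by rw [← mul_pow]; simp
  linear_combination (-((T ω x : ℂ) * sphHarm ℓ m x)) * hsq

/-- The partial sums of a real field are real, since `Y_{ℓ,-m} = (-1)^m conj Y_{ℓ,m}`. -/
lemma conj_partialSum (T : Ω → S2 → ℝ) (L : ℕ) (x : S2) (ω : Ω) :
    (starRingEnd ℂ) (partialSum T L x ω) = partialSum T L x ω := by
  unfold partialSum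
  rw [map_sum]
  refine Finset.sum_congr rfl fun ℓ _ => ?_
  rw [map_sum]
  refine Fintype.sum_equiv ⟨Order.neg, Order.neg, Order.neg_neg, Order.neg_neg⟩ _ _ fun m => ?_
  rw [map_mul, conj_coeffBlock, conj_sphHarm]
  have hsq : ((-1 : ℂ) ^ (m : ℤ).natAbs) * (-1) ^ (m : ℤ).natAbs = 1 := by rw [← mul_pow]; simp
  change _ = coeffBlock T ℓ ω m.neg * sphHarm ℓ (-m) x
  linear_combination (coeffBlock T ℓ ω m.neg * sphHarm ℓ (-m) x) * hsq

lemma ofReal_re_partialSum (T : Ω → S2 → ℝ) (L : ℕ) (x : S2) (ω : Ω) :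
    ((partialSum T L x ω).re : ℂ) = partialSum T L x ω :=
  Complex.conj_eq_iff_re.1 (conj_partialSum T L x ω)

lemma levelSum_rotate (T : Ω → S2 → ℝ) (ℓ : ℕ) (ρ : Rot3) (x : S2) (ω : Ω) :
    levelSum T ℓ (rotate ρ x) ω =
      ∑ m : Order ℓ, (wignerD ℓ ρ⁻¹).mulVec (coeffBlock T ℓ ω) m * sphHarm ℓ m x := by
  have h : ∀ m : Order ℓ, sphHarm ℓ m (rotate ρ x) =
      ∑ m' : Order ℓ, wignerD ℓ ρ⁻¹ m' m * sphHarm ℓ m' x := fun m => by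
    rw [← sphHarm_rotate, inv_inv]
  simp only [levelSum, h, Matrix.mulVec, dotProduct, Finset.mul_sum, Finset.sum_mul]
  rw [Finset.sum_comm]
  refine Finset.sum_congr rfl fun m' _ => Finset.sum_congr rfl fun m _ => ?_
  ring

variable [MeasurableSpace Ω] {T : Ω → S2 → ℝ}

lemma measurable_coeffBlock (hT : Measurable (Function.uncurry T)) (ℓ : ℕ) (m : Order ℓ) :
    Measurable fun ω => coeffBlock T ℓ ω m := by
  have h : Measurable fun p : Ω × S2 => (T p.1 p.2 : ℂ) * (starRingEnd ℂ) (sphHarm ℓ m p.2) := by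
    have h1 : Measurable fun p : Ω × S2 => T p.1 p.2 := hT
    have h2 := (continuous_sphHarm ℓ m).measurable
    exact (Complex.measurable_ofReal.comp h1).mul
      (Complex.continuous_conj.measurable.comp (h2.comp measurable_snd))
  exact (h.stronglyMeasurable.integral_prod_right' (ν := surfaceMeasure)).measurable

lemma measurable_partialSum (hT : Measurable (Function.uncurry T)) (L : ℕ) :
    Measurable fun p : Ω × S2 => partialSum T L p.2 p.1 := by
  unfold partialSum
  refine Finset.measurable_fun_sum _ fun ℓ _ => Finset.measurable_fun_sum _ fun m _ => ?_
  exact ((measurable_coeffBlock hT ℓ m).comp measurable_fst).mul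
    ((continuous_sphHarm ℓ m).measurable.comp measurable_snd)

lemma measurable_partialSum_apply (hT : Measurable (Function.uncurry T)) (L : ℕ) (x : S2) :
    Measurable fun ω => partialSum T L x ω :=
  Measurable.comp (g := fun p : Ω × S2 => partialSum T L p.2 p.1) (f := fun ω => (ω, x))
    (measurable_partialSum hT L) measurable_prodMk_right

/-- Invariance of the coefficient blocks, in terms of the partial sums at finitely many points. -/
lemma CoeffInvariant.identDistrib_partialSum {P : Measure Ω} (hinv : CoeffInvariant P T)
    {κ : Type*} (x : κ → S2) (ρ : Rot3) (N : ℕ) :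
    IdentDistrib (fun ω (p : Fin (N + 1) × κ) => partialSum T p.1 (x p.2) ω)
      (fun ω (p : Fin (N + 1) × κ) => partialSum T p.1 (rotate ρ (x p.2)) ω) P P := by
  have h := (hinv ρ⁻¹ (N + 1) (by omega) (fun i => (i : ℕ))).symm
  let u : ((i : Fin (N + 1)) → Order (i : ℕ) → ℂ) → Fin (N + 1) × κ → ℂ := fun a p =>
    ∑ i : Fin (N + 1), if (i : ℕ) < p.1 + 1 then ∑ m, a i m * sphHarm i m (x p.2) else 0
  have hu : Measurable u := by
    refine measurable_pi_lambda _ fun p => Finset.measurable_fun_sum _ fun i _ => ?_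
    split_ifs
    · fun_prop
    · exact measurable_const
  have hsum : ∀ (g : ℕ → ℂ) (n : Fin (N + 1)), ∑ ℓ ∈ Finset.range (n + 1), g ℓ =
      ∑ i : Fin (N + 1), if (i : ℕ) < n + 1 then g i else 0 := by
    intro g n
    rw [Fin.sum_univ_eq_sum_range (fun i => if i < (n : ℕ) + 1 then g i else 0) (N + 1),
      ← Finset.sum_filter]
    refine Finset.sum_congr ?_ fun _ _ => rfl
    ext k
    have := n.2
    simp only [Finset.mem_range, Finset.mem_filter]
    omega
  have h1 : (fun ω (p : Fin (N + 1) × κ) => partialSum T p.1 (x p.2) ω) =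
      u ∘ fun ω (i : Fin (N + 1)) => coeffBlock T i ω := by
    funext ω p
    rw [partialSum_eq_sum_levelSum, hsum]
    rfl
  have h2 : (fun ω (p : Fin (N + 1) × κ) => partialSum T p.1 (rotate ρ (x p.2)) ω) =
      u ∘ fun ω (i : Fin (N + 1)) => (wignerD i ρ⁻¹).mulVec (coeffBlock T i ω) := by
    funext ω p
    rw [partialSum_eq_sum_levelSum, hsum]
    simp only [levelSum_rotate]
    rfl
  rw [h1, h2]
  exact h.comp hu

end RandomField

/-! ### Limits in probability and second moments -/

section Limits

variable {Ω : Type*} [MeasurableSpace Ω] {P : Measure Ω}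

lemma tendstoInMeasure_pi_of_forall {E κ : Type*} [PseudoEMetricSpace E] [Fintype κ]
    {X : ℕ → Ω → κ → E} {Z : Ω → κ → E}
    (h : ∀ i, TendstoInMeasure P (fun n ω => X n ω i) atTop (fun ω => Z ω i)) :
    TendstoInMeasure P X atTop Z := by
  intro ε hε
  have h0 : Tendsto (fun n => ∑ i, P {ω | ε ≤ edist (X n ω i) (Z ω i)}) atTop (𝓝 0) := by
    simpa using tendsto_finsetSum Finset.univ fun i _ => h i ε hε
  refine tendsto_of_tendsto_of_tendsto_of_le_of_le tendsto_const_nhds h0 (fun _ => zero_le) ?_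
  intro n
  refine le_trans (measure_mono ?_) (measure_iUnion_fintype_le P _)
  intro ω hω
  by_contra hcon
  simp only [Set.mem_iUnion, Set.mem_ofPred_eq, not_exists, not_le] at hcon hω
  refine absurd hω (not_le.2 ?_)
  rw [edist_pi_def, Finset.sup_lt_iff hε]
  exact fun i _ => hcon i

/-- Equality in law passes to limits in probability. -/
lemma identDistrib_of_tendstoInMeasure [IsProbabilityMeasure P] {E κ : Type*}
    [NormedAddCommGroup E] [SecondCountableTopology E] [MeasurableSpace E] [BorelSpace E]
    [Fintype κ] {X X' : ℕ → Ω → κ → E} {Z Z' : Ω → κ → E}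
    (h : ∀ n, IdentDistrib (X n) (X' n) P P)
    (hX : ∀ i, TendstoInMeasure P (fun n ω => X n ω i) atTop (fun ω => Z ω i))
    (hX' : ∀ i, TendstoInMeasure P (fun n ω => X' n ω i) atTop (fun ω => Z' ω i)) :
    IdentDistrib Z Z' P P := by
  have d := (tendstoInMeasure_pi_of_forall hX).tendstoInDistribution
    fun n => (h n).aemeasurable_fst
  have d' := (tendstoInMeasure_pi_of_forall hX').tendstoInDistribution
    fun n => (h n).aemeasurable_snd
  have d2 : TendstoInDistribution X' atTop Z (fun _ => P) P :=
    ⟨d'.forall_aemeasurable, d.aemeasurable_limit,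
      d.tendsto.congr fun n => Subtype.ext (h n).map_eq⟩
  exact ⟨d.aemeasurable_limit, d'.aemeasurable_limit, tendstoInDistribution_unique X' d2 d'⟩

lemma eLpNorm_two_sq {α E : Type*} [MeasurableSpace α] {μ : Measure α} [NormedAddCommGroup E]
    (f : α → E) : eLpNorm f 2 μ ^ 2 = ∫⁻ x, ‖f x‖ₑ ^ 2 ∂μ := by
  have h := eLpNorm_nnreal_pow_eq_lintegral (μ := μ) (f := f) (p := 2) two_ne_zero
  simpa using h

lemma tendsto_zero_of_sq {ι : Type*} {l : Filter ι} {a : ι → ℝ≥0∞}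
    (h : Tendsto (fun i => a i ^ 2) l (𝓝 0)) : Tendsto a l (𝓝 0) := by
  have h1 := ((ENNReal.continuous_rpow_const (y := 1 / 2)).tendsto 0).comp h
  rw [ENNReal.zero_rpow_of_pos (by norm_num)] at h1
  refine h1.congr fun i => ?_
  simp only [Function.comp_apply]
  rw [← ENNReal.rpow_natCast, ← ENNReal.rpow_mul]
  norm_num

lemma tendsto_sq_zero {ι : Type*} {l : Filter ι} {a : ι → ℝ≥0∞} (h : Tendsto a l (𝓝 0)) :
    Tendsto (fun i => a i ^ 2) l (𝓝 0) := by
  simpa using ENNReal.Tendsto.pow (n := 2) h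

lemma eLpNorm_prod_two_sq {f : Ω × S2 → ℂ} (hf : Measurable f) :
    eLpNorm f 2 (P.prod surfaceMeasure) ^ 2 =
      ∫⁻ ω, eLpNorm (fun x => f (ω, x)) 2 surfaceMeasure ^ 2 ∂P := by
  simp only [eLpNorm_two_sq]
  exact lintegral_prod _ (hf.enorm.pow_const 2).aemeasurable

lemma eLpNorm_prod_two_sq_symm [SFinite P] {f : Ω × S2 → ℂ} (hf : Measurable f) :
    eLpNorm f 2 (P.prod surfaceMeasure) ^ 2 =
      ∫⁻ x, eLpNorm (fun ω => f (ω, x)) 2 P ^ 2 ∂surfaceMeasure := by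
  simp only [eLpNorm_two_sq]
  exact lintegral_prod_symm _ (hf.enorm.pow_const 2).aemeasurable

end Limits

/-! ### Convergence of the expansion of an isotropic field -/

section Convergence

variable {Ω : Type*} [MeasurableSpace Ω] {P : Measure Ω} {T : Ω → S2 → ℝ}

lemma measurable_ofReal_uncurry {F : Ω → S2 → ℝ} (hF : Measurable (Function.uncurry F)) :
    Measurable fun p : Ω × S2 => (F p.1 p.2 : ℂ) :=
  Complex.measurable_ofReal.comp hF

lemma tendsto_eLpNorm_prod_sub_partialSum [SFinite P] (hT : Measurable (Function.uncurry T))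
    (hT2 : MemLp (Function.uncurry T) 2 (P.prod surfaceMeasure)) :
    Tendsto (fun L => eLpNorm (fun p : Ω × S2 => (T p.1 p.2 : ℂ) - partialSum T L p.2 p.1) 2
      (P.prod surfaceMeasure)) atTop (𝓝 0) := by
  apply tendsto_zero_of_sq
  have hm : ∀ L, Measurable fun p : Ω × S2 => (T p.1 p.2 : ℂ) - partialSum T L p.2 p.1 :=
    fun L => (measurable_ofReal_uncurry hT).sub (measurable_partialSum hT L)
  simp only [eLpNorm_prod_two_sq (hm _)]
  have hfin : ∫⁻ ω, eLpNorm (fun x => (T ω x : ℂ)) 2 surfaceMeasure ^ 2 ∂P ≠ ∞ := by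
    have h := eLpNorm_prod_two_sq (P := P) (measurable_ofReal_uncurry hT)
    rw [← h]
    exact ENNReal.pow_ne_top hT2.ofReal.eLpNorm_ne_top
  have hsec : ∀ ω, Measurable fun x => (T ω x : ℂ) := fun ω =>
    Complex.measurable_ofReal.comp (hT.comp measurable_prodMk_left)
  have hmeas : ∀ f : Ω × S2 → ℂ, Measurable f →
      Measurable fun ω => eLpNorm (fun x => f (ω, x)) 2 surfaceMeasure ^ 2 := by
    intro f hf
    simp only [eLpNorm_two_sq]
    exact (hf.enorm.pow_const 2).lintegral_prod_right'
  -- elsewhere the coefficients may be junk values of non-convergent integrals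
  have hmem : ∀ᵐ ω ∂P, MemLp (fun x => (T ω x : ℂ)) 2 surfaceMeasure := by
    have hm0 := hmeas (fun p : Ω × S2 => (T p.1 p.2 : ℂ)) (measurable_ofReal_uncurry hT)
    filter_upwards [ae_lt_top hm0 hfin] with ω hω
    exact ⟨(hsec ω).aestronglyMeasurable, (ENNReal.pow_lt_top_iff.1 hω).resolve_right two_ne_zero⟩
  have hm2 : ∀ L, Measurable
      fun ω => eLpNorm (fun x => (T ω x : ℂ) - partialSum T L x ω) 2 surfaceMeasure ^ 2 :=
    fun L => hmeas (fun p : Ω × S2 => (T p.1 p.2 : ℂ) - partialSum T L p.2 p.1) (hm L)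
  have hbound : ∀ L, ∀ᵐ ω ∂P,
      eLpNorm (fun x => (T ω x : ℂ) - partialSum T L x ω) 2 surfaceMeasure ^ 2 ≤
        (2 * eLpNorm (fun x => (T ω x : ℂ)) 2 surfaceMeasure) ^ 2 := by
    intro L
    filter_upwards [hmem] with ω hω
    exact pow_le_pow_left' (eLpNorm_sub_harmSum_le hω L) 2
  have hfin2 : ∫⁻ ω, (2 * eLpNorm (fun x => (T ω x : ℂ)) 2 surfaceMeasure) ^ 2 ∂P ≠ ∞ := by
    simp only [mul_pow]
    rw [lintegral_const_mul' _ _ (by norm_num)]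
    exact ENNReal.mul_ne_top (by norm_num) hfin
  have hlim : ∀ᵐ ω ∂P, Tendsto (fun L =>
      eLpNorm (fun x => (T ω x : ℂ) - partialSum T L x ω) 2 surfaceMeasure ^ 2) atTop (𝓝 0) := by
    filter_upwards [hmem] with ω hω
    exact tendsto_sq_zero (tendsto_eLpNorm_sub_harmSum hω)
  have h := tendsto_lintegral_of_dominated_convergence _ hm2 hbound hfin2 hlim
  rwa [lintegral_zero] at h

/-- The variance of an increment of the expansion does not depend on the point. -/
lemma CoeffInvariant.eLpNorm_increment_eq (hinv : CoeffInvariant P T) (L M : ℕ) (x y : S2) :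
    eLpNorm (fun ω => partialSum T L x ω - partialSum T M x ω) 2 P =
      eLpNorm (fun ω => partialSum T L y ω - partialSum T M y ω) 2 P := by
  obtain ⟨ρ, rfl⟩ := exists_rotate_eq x y
  have h := hinv.identDistrib_partialSum (fun _ : Unit => x) ρ (max L M)
  have h1 := h.comp
    (u := fun v : Fin (max L M + 1) × Unit → ℂ => v (⟨L, by omega⟩, ()) - v (⟨M, by omega⟩, ()))
    (by refine Measurable.sub ?_ ?_ <;> exact measurable_pi_apply _)
  exact h1.eLpNorm_eq 2

/-- The increments of the expansion have the same variance everywhere, so the convergence in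
`L²(Ω × S²)` controls them pointwise. -/
lemma CoeffInvariant.eLpNorm_increment_lt [SFinite P] (hinv : CoeffInvariant P T)
    (hT : Measurable (Function.uncurry T))
    (hT2 : MemLp (Function.uncurry T) 2 (P.prod surfaceMeasure)) {ε : ℝ≥0∞} (hε : 0 < ε) :
    ∃ N, ∀ n m, N ≤ n → N ≤ m → ∀ x,
      eLpNorm (fun ω => partialSum T n x ω - partialSum T m x ω) 2 P < ε := by
  set K : ℝ≥0∞ := surfaceMeasure Set.univ ^ (1 / 2 : ℝ) with hK
  have hc0 : surfaceMeasure Set.univ ≠ 0 := by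
    rw [surfaceMeasure, Measure.measure_univ_ne_zero]; exact Measure.toSphere_ne_zero _
  have hK0 : K ≠ 0 := by
    rw [hK, Ne, ENNReal.rpow_eq_zero_iff]
    simp [hc0]
  have hK2 : K ^ 2 = surfaceMeasure Set.univ := by
    rw [hK, ← ENNReal.rpow_natCast, ← ENNReal.rpow_mul]
    norm_num
  have hE := tendsto_eLpNorm_prod_sub_partialSum hT hT2
  have hpos : 0 < ε * K / 2 := ENNReal.div_pos (mul_ne_zero hε.ne' hK0) (by norm_num)
  obtain ⟨N, hN⟩ := eventually_atTop.1 (hE.eventually (gt_mem_nhds hpos))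
  refine ⟨N, fun n m hn hm x => ?_⟩
  have hmeas : ∀ L, Measurable fun p : Ω × S2 => (T p.1 p.2 : ℂ) - partialSum T L p.2 p.1 :=
    fun L => (measurable_ofReal_uncurry hT).sub (measurable_partialSum hT L)
  have h1 : eLpNorm (fun ω => partialSum T n x ω - partialSum T m x ω) 2 P * K =
      eLpNorm (fun p : Ω × S2 => partialSum T n p.2 p.1 - partialSum T m p.2 p.1) 2
        (P.prod surfaceMeasure) := by
    have hsq := eLpNorm_prod_two_sq_symm (P := P)
      ((measurable_partialSum hT n).sub (measurable_partialSum hT m))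
    simp only [Pi.sub_apply, hinv.eLpNorm_increment_eq n m _ x, lintegral_const] at hsq
    rw [← hK2, ← mul_pow] at hsq
    exact (ENNReal.pow_right_strictMono two_ne_zero).injective hsq.symm
  have h2 : eLpNorm (fun p : Ω × S2 => partialSum T n p.2 p.1 - partialSum T m p.2 p.1) 2
        (P.prod surfaceMeasure) < ε * K := by
    have h3 := eLpNorm_sub_le (p := 2) (μ := P.prod surfaceMeasure)
      (hmeas m).aestronglyMeasurable (hmeas n).aestronglyMeasurable (by norm_num)
    have h4 : (fun p : Ω × S2 => partialSum T n p.2 p.1 - partialSum T m p.2 p.1) =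
        (fun p : Ω × S2 => (T p.1 p.2 : ℂ) - partialSum T m p.2 p.1) -
        (fun p : Ω × S2 => (T p.1 p.2 : ℂ) - partialSum T n p.2 p.1) := by
      funext p; simp
    rw [h4]
    calc _ ≤ _ := h3
      _ < ε * K / 2 + ε * K / 2 := ENNReal.add_lt_add (hN m hm) (hN n hn)
      _ = ε * K := ENNReal.add_halves _
  rw [← h1] at h2
  exact lt_of_mul_lt_mul_right' h2

/-- The expansion converges in `L²(Ω)` at every point, uniformly on the sphere, to a jointly
measurable real field. -/
lemma CoeffInvariant.exists_uniform_limit [SFinite P] (hinv : CoeffInvariant P T)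
    (hT : Measurable (Function.uncurry T))
    (hT2 : MemLp (Function.uncurry T) 2 (P.prod surfaceMeasure)) :
    ∃ T' : Ω → S2 → ℝ, Measurable (Function.uncurry T') ∧ ∀ ε : ℝ≥0∞, 0 < ε → ∃ N, ∀ L, N ≤ L →
      ∀ x, eLpNorm (fun ω => partialSum T L x ω - (T' ω x : ℂ)) 2 P ≤ ε := by
  set B : ℕ → ℝ≥0∞ := fun k => 2⁻¹ ^ k
  have hB : ∑' k, B k ≠ ∞ := by simp [B, ENNReal.tsum_geometric]
  have hB0 : ∀ k, 0 < B k := fun k => ENNReal.pow_pos (by simp) k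
  choose N hN using fun k => hinv.eLpNorm_increment_lt hT hT2 (hB0 k)
  -- a subsequence whose increments are summable, uniformly on the sphere
  set φ : ℕ → ℕ := fun k => k + (Finset.range (k + 1)).sup N with hφ
  have hφN : ∀ K n, K ≤ n → N K ≤ φ n := fun K n h =>
    (Finset.le_sup (f := N) (Finset.mem_range.2 (by omega))).trans (Nat.le_add_left _ _)
  have hφk : ∀ k, k ≤ φ k := fun k => Nat.le_add_right _ _
  have hcau : ∀ x, ∀ K n m, K ≤ n → K ≤ m →
      eLpNorm ((fun ω => partialSum T (φ n) x ω) - fun ω => partialSum T (φ m) x ω) 2 P < B K :=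
    fun x K n m hn hm => hN K _ _ (hφN K n hn) (hφN K m hm) x
  have hsm : ∀ L x, AEStronglyMeasurable (fun ω => partialSum T L x ω) P := fun L x =>
    (measurable_partialSum_apply hT L x).aestronglyMeasurable
  -- the upper limit is measurable everywhere, and is the limit wherever that exists
  refine ⟨fun ω x => limsup (fun k => (partialSum T (φ k) x ω).re) atTop, ?_, ?_⟩
  · exact Measurable.limsup fun k => Complex.measurable_re.comp (measurable_partialSum hT (φ k))
  have hlim : ∀ x, ∀ᵐ ω ∂P, Tendsto (fun k => partialSum T (φ k) x ω) atTop
      (𝓝 ((limsup (fun k => (partialSum T (φ k) x ω).re) atTop : ℝ) : ℂ)) := by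
    intro x
    filter_upwards [Lp.ae_tendsto_of_cauchy_eLpNorm (fun k => hsm (φ k) x) (by norm_num) hB
      (hcau x)] with ω hω
    obtain ⟨l, hl⟩ := hω
    have hre := (Complex.continuous_re.tendsto l).comp hl
    have h1 : limsup (fun k => (partialSum T (φ k) x ω).re) atTop = l.re := hre.limsup_eq
    rw [h1]
    have h2 := (Complex.continuous_ofReal.tendsto l.re).comp hre
    exact h2.congr fun k => ofReal_re_partialSum T (φ k) x ω
  intro ε hε
  obtain ⟨M, hM⟩ := hinv.eLpNorm_increment_lt hT hT2 hε
  refine ⟨M, fun L hL x => ?_⟩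
  have hsub := Lp.cauchy_tendsto_of_tendsto (fun k => hsm (φ k) x) _ hB (hcau x) (hlim x)
  have hsub' := hsub.const_add ε
  rw [add_zero] at hsub'
  refine ge_of_tendsto hsub' ?_
  filter_upwards [eventually_ge_atTop M] with k hk
  have hlm : AEStronglyMeasurable
      (fun ω => ((limsup (fun k => (partialSum T (φ k) x ω).re) atTop : ℝ) : ℂ)) P :=
    (Complex.measurable_ofReal.comp (Measurable.limsup fun k =>
      Complex.measurable_re.comp (measurable_partialSum_apply hT (φ k) x))).aestronglyMeasurable
  have htri := eLpNorm_add_le (p := 2) (μ := P) ((hsm L x).sub (hsm (φ k) x))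
    ((hsm (φ k) x).sub hlm) (by norm_num)
  rw [sub_add_sub_cancel] at htri
  exact htri.trans (add_le_add_left (hM L (φ k) hL (hk.trans (hφk k)) x).le _)

/-- A field given at every point by the expansion of a field with invariant coefficients is
strongly isotropic. -/
lemma CoeffInvariant.stronglyIsotropic [IsProbabilityMeasure P] (hinv : CoeffInvariant P T)
    {F : Ω → S2 → ℝ} (hF : ∀ x : S2, TendstoInMeasure P (fun (L : ℕ) ω => partialSum T L x ω) atTop
      (fun ω => (F ω x : ℂ))) : StronglyIsotropic P F := by
  intro k x ρ
  have h := identDistrib_of_tendstoInMeasure (P := P)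
    (X := fun L ω i => partialSum T L (x i) ω)
    (X' := fun L ω i => partialSum T L (rotate ρ (x i)) ω)
    (Z := fun ω i => (F ω (x i) : ℂ)) (Z' := fun ω i => (F ω (rotate ρ (x i)) : ℂ))
    (fun L => (hinv.identDistrib_partialSum x ρ L).comp
      (u := fun (v : Fin (L + 1) × Fin k → ℂ) (i : Fin k) => v (Fin.last L, i))
      (measurable_pi_lambda _ fun _ => measurable_pi_apply _))
    (fun i => hF (x i)) (fun i => hF (rotate ρ (x i)))
  exact h.comp (u := fun (v : Fin k → ℂ) (i : Fin k) => (v i).re)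
    (measurable_pi_lambda _ fun i => Complex.measurable_re.comp (measurable_pi_apply i))

/-- A field which is continuous in probability inherits strong isotropy from its versions: on a
dense set of points it agrees with the version almost surely. -/
lemma StronglyIsotropic.of_ae_eq [IsProbabilityMeasure P] {F : Ω → S2 → ℝ}
    (hF : StronglyIsotropic P F) (hFm : Measurable (Function.uncurry F))
    (hT : Measurable (Function.uncurry T))
    (hae : Function.uncurry F =ᵐ[P.prod surfaceMeasure] Function.uncurry T)
    (hcont : ∀ x : S2, TendstoInMeasure P (fun (y : S2) ω => T ω y) (𝓝 x) (fun ω => T ω x)) :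
    StronglyIsotropic P T := by
  intro k x ρ
  have h1 : ∀ᵐ y ∂surfaceMeasure, ∀ᵐ ω ∂P, F ω y = T ω y :=
    (Measure.ae_ae_comm (p := fun ω y => F ω y = T ω y) (measurableSet_eq_fun hFm hT)).1
      (Measure.ae_ae_of_ae_prod hae)
  have h2 : ∀ᵐ y ∂surfaceMeasure, ∀ᵐ ω ∂P, F ω (rotate ρ y) = T ω (rotate ρ y) :=
    (measurePreserving_sphereMap ρ).quasiMeasurePreserving.ae h1
  have hdense := Measure.dense_of_ae (h1.and h2)
  choose y hy hlim using fun i => mem_closure_iff_seq_limit.1 (hdense (x i))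
  refine identDistrib_of_tendstoInMeasure (X := fun n ω i => T ω (y i n))
    (X' := fun n ω i => T ω (rotate ρ (y i n))) (fun n => ?_)
    (fun i => (hcont (x i)).comp (hlim i)) (fun i => ?_)
  · have hm : ∀ {G : Ω → S2 → ℝ}, Measurable (Function.uncurry G) → ∀ z : Fin k → S2,
        AEMeasurable (fun ω i => G ω (z i)) P := fun hG z =>
      (measurable_pi_lambda _ fun i => hG.comp measurable_prodMk_right).aemeasurable
    have e1 : (fun ω i => T ω (y i n)) =ᵐ[P] fun ω i => F ω (y i n) := by
      filter_upwards [ae_all_iff.2 fun i => (hy i n).1] with ω hω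
      exact funext fun i => (hω i).symm
    have e2 : (fun ω i => F ω (rotate ρ (y i n))) =ᵐ[P] fun ω i => T ω (rotate ρ (y i n)) := by
      filter_upwards [ae_all_iff.2 fun i => (hy i n).2] with ω hω
      exact funext hω
    exact ((IdentDistrib.of_ae_eq (hm hT _) e1).trans (hF k (fun i => y i n) ρ)).trans
      (IdentDistrib.of_ae_eq (hm hFm _) e2)
  · exact (hcont (rotate ρ (x i))).comp
      (((continuous_sphereMap ρ).tendsto (x i)).comp (hlim i))

end Convergence

theorem theorem1 {Ω : Type*} [MeasurableSpace Ω] (P : Measure Ω) [IsProbabilityMeasure P]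
    (T : Ω → S2 → ℝ) (hT : Measurable (Function.uncurry T))
    (hT2 : MemLp (Function.uncurry T) 2 (P.prod surfaceMeasure))
    (hinv : CoeffInvariant P T) :
    (∃ T' : Ω → S2 → ℝ,
      Measurable (Function.uncurry T') ∧
      Function.uncurry T' =ᵐ[P.prod surfaceMeasure] Function.uncurry T ∧
      (∀ x : S2, Tendsto (fun L : ℕ => eLpNorm (fun ω => partialSum T L x ω - (T' ω x : ℂ)) 2 P)
        atTop (𝓝 0)) ∧
      StronglyIsotropic P T') ∧
    ((∀ x : S2, TendstoInMeasure P (fun (L : ℕ) ω => partialSum T L x ω) atTop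
        (fun ω => (T ω x : ℂ))) → StronglyIsotropic P T) ∧
    ((∀ x : S2, TendstoInMeasure P (fun (y : S2) ω => T ω y) (𝓝 x) (fun ω => T ω x)) →
      StronglyIsotropic P T) := by
  obtain ⟨T', hT'm, hunif⟩ := hinv.exists_uniform_limit hT hT2
  have hpt : ∀ x : S2, Tendsto
      (fun L : ℕ => eLpNorm (fun ω => partialSum T L x ω - (T' ω x : ℂ)) 2 P) atTop (𝓝 0) := by
    intro x
    rw [ENNReal.tendsto_atTop_zero]
    intro ε hε
    obtain ⟨N, hN⟩ := hunif ε hε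
    exact ⟨N, fun L hL => hN L hL x⟩
  have hiso : StronglyIsotropic P T' := by
    refine hinv.stronglyIsotropic fun x => ?_
    refine tendstoInMeasure_of_tendsto_eLpNorm (p := 2) (by norm_num)
      (fun L => (measurable_partialSum_apply hT L x).aestronglyMeasurable) ?_ (hpt x)
    exact (Complex.measurable_ofReal.comp
      (hT'm.comp measurable_prodMk_right)).aestronglyMeasurable
  have hae : Function.uncurry T' =ᵐ[P.prod surfaceMeasure] Function.uncurry T := by
    have hm' : ∀ L, Measurable fun p : Ω × S2 => partialSum T L p.2 p.1 - (T' p.1 p.2 : ℂ) :=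
      fun L => (measurable_partialSum hT L).sub (measurable_ofReal_uncurry hT'm)
    have hm : ∀ L, Measurable fun p : Ω × S2 => (T p.1 p.2 : ℂ) - partialSum T L p.2 p.1 :=
      fun L => (measurable_ofReal_uncurry hT).sub (measurable_partialSum hT L)
    -- integrate the uniform bound over the sphere
    have hlim' : Tendsto (fun L => eLpNorm
        (fun p : Ω × S2 => partialSum T L p.2 p.1 - (T' p.1 p.2 : ℂ)) 2 (P.prod surfaceMeasure))
        atTop (𝓝 0) := by
      apply tendsto_zero_of_sq
      simp only [eLpNorm_prod_two_sq_symm (hm' _)]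
      have h := tendsto_lintegral_filter_of_dominated_convergence (μ := surfaceMeasure)
        (F := fun L x => eLpNorm (fun ω => partialSum T L x ω - (T' ω x : ℂ)) 2 P ^ 2)
        (f := fun _ => 0) (l := atTop) (fun _ => 1)
        (Eventually.of_forall fun L => by
          simp only [eLpNorm_two_sq]
          exact ((hm' L).enorm.pow_const 2).lintegral_prod_left')
        (by
          obtain ⟨N, hN⟩ := hunif 1 one_pos
          filter_upwards [eventually_ge_atTop N] with L hL
          exact Eventually.of_forall fun x => pow_le_one₀ zero_le (hN L hL x))
        (by simp)
        (Eventually.of_forall fun x => tendsto_sq_zero (hpt x))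
      simpa using h
    have hzero : eLpNorm (fun p : Ω × S2 => (T p.1 p.2 : ℂ) - (T' p.1 p.2 : ℂ)) 2
        (P.prod surfaceMeasure) = 0 := by
      refine le_antisymm ?_ zero_le
      have h0 := (tendsto_eLpNorm_prod_sub_partialSum hT hT2).add hlim'
      rw [add_zero] at h0
      refine ge_of_tendsto' h0 fun L => ?_
      have htri := eLpNorm_add_le (p := 2) (μ := P.prod surfaceMeasure)
        (hm L).aestronglyMeasurable (hm' L).aestronglyMeasurable (by norm_num)
      refine le_trans (le_of_eq ?_) htri
      congr 1
      funext p
      simp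
    have hmT : Measurable fun p : Ω × S2 => (T p.1 p.2 : ℂ) - (T' p.1 p.2 : ℂ) :=
      (measurable_ofReal_uncurry hT).sub (measurable_ofReal_uncurry hT'm)
    rw [eLpNorm_eq_zero_iff hmT.aestronglyMeasurable two_ne_zero] at hzero
    filter_upwards [hzero] with p hp
    have h1 : (T p.1 p.2 : ℂ) - (T' p.1 p.2 : ℂ) = 0 := hp
    exact (Complex.ofReal_injective (sub_eq_zero.1 h1)).symm
  exact ⟨⟨T', hT'm, hae, hpt, hiso⟩, fun h => hinv.stronglyIsotropic h,
    fun h => hiso.of_ae_eq hT'm hT hae h⟩
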